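/- Let $L,T,h>0$, $\alpha\in\mathbb R$, $\beta>0$ satisfy $0<2\alpha^2+\tfrac32\beta<\tfrac12$. Let $X_0=L^2(0,L)^2$ and let $H=X_0\times L^2(0,1)$ (real-valued functions) have the norm $\|(u,v,z)\|_H^2=\|u\|_{L^2(0,L)}^2+\|v\|_{L^2(0,L)}^2+\beta h\|z\|_{L^2(0,1)}^2$. Consider the system $$u_t-\tfrac12u_{xxx}=f_1,\qquad v_t+v_{xxx}=f_2\qquad (x\in(0,L)),\qquad h z_t+z_\rho=0\qquad(\rho\in(0,1)),$$ $$u(t,0)=u(t,L)=v(t,0)=v(t,L)=u_x(t,0)=0,\qquad v_x(t,L)=\alpha u_x(t,L)+\beta z(t,1),\qquad z(t,0)=u_x(t,L),$$ $$(u,v,z)(0)=U_0=(u_0,v_0,z_0),$$ where $z(t,\rho)$ stands for $u_x(t-h\rho,L)$. Let $A(u,v,z)=(\tfrac12u_{xxx},-v_{xxx},-\tfrac1h z_\rho)$ with domain $$D(A)=\{(u,v)\in[H^3(0,L)\cap H^1_0(0,L)]^2,\ z\in H^1(0,1):\ u_x(0)=0,\ z(0)=u_x(L),\ v_x(L)=\alpha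 u_x(L)+\beta z(1)\}.$$ A solution of the system is a (mild) solution $U=(u,v,z)\in C([0,T];H)$ of $U'=AU+(f_1,f_2,0)$, $U(0)=U_0$, that is, $\int_0^tU\,ds\in D(A)$ and $U(t)=U_0+A\int_0^tU\,ds+\int_0^t(f_1,f_2,0)\,ds$ for all $t\in[0,T]$. Then for all $U_0\in H$ and $(f_1,f_2)\in L^1(0,T;X_0)$ there is exactly one solution $U=(u,v,z)\in C([0,T];H)$. Moreover $(u,v)\in L^2(0,T;[H^1(0,L)]^2)$, the traces $u_x(\cdot,L)$ and $z(\cdot,1)$ exist in $L^2(0,T)$ (as the functions whose integrals over $(0,t)$ are $\partial_x\big(\int_0^tu\,ds\big)(L)$ and $\big(\int_0^tz\,ds\big)(1)$ for all $t\in[0,T]$), and there is a constant $C>0$, independent of $U_0,f_1,f_2$, such that $$\sup_{t\in[0,T]}\|U(t)\|_H\le C\big(\|U_0\|_H+\|(f_1,f_2)\|_{L^1(0,T;X_0)}\big),$$ $$\int_0^T\big(|u_x(t,L)|^2+|z(t,1)|^2\big)\,dt\le C\big(\|U_0\|_H^2+\|(f_1,f_2)\|_{L^1(0,T;X_0)}^2\big),$$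 $$\|(u,v)\|_{L^2(0,T;[H^1(0,L)]^2)}\le C\big(\|U_0\|_H+\|(f_1,f_2)\|_{L^1(0,T;X_0)}\big).$$ -/

import Mathlib

open MeasureTheory Set
open scoped ContDiff

noncomputable section

namespace HirotaSatsuma

/-- The real Hilbert space `L²(0, ℓ)`. -/
abbrev L2 (ℓ : ℝ) : Type := Lp ℝ 2 (volume.restrict (Ioo (0 : ℝ) ℓ))

/-- The state space `H = L²(0, L)² × L²(0, 1)`, whose elements are the triples `(u, v, z)`.
The type carries the product topology; the Hilbert norm of `H` is `normH` below, which
induces that same topology when `β h > 0`. -/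
abbrev StateSpace (L : ℝ) : Type := L2 L × L2 L × L2 1

/-- The norm of `X₀ = L²(0, L)²`. -/
def normX0 {L : ℝ} (f g : L2 L) : ℝ := Real.sqrt (‖f‖ ^ 2 + ‖g‖ ^ 2)

/-- The norm of `H` that comes from the inner product
`⟨(u, v, z), (u', v', z')⟩ = ⟨(u, v), (u', v')⟩_{X₀} + β h ⟨z, z'⟩_{L²(0, 1)}`. -/
def normH {L : ℝ} (β h : ℝ) (U : StateSpace L) : ℝ :=
  Real.sqrt (‖U.1‖ ^ 2 + ‖U.2.1‖ ^ 2 + β * h * ‖U.2.2‖ ^ 2)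

/-- `g ∈ L²(0, ℓ)` is the weak derivative of `f ∈ L²(0, ℓ)`. -/
def IsWeakDeriv (ℓ : ℝ) (f g : L2 ℓ) : Prop :=
  ∀ φ : ℝ → ℝ, ContDiff ℝ ∞ φ → HasCompactSupport φ → tsupport φ ⊆ Ioo 0 ℓ →
    ∫ x in Ioo 0 ℓ, f x * deriv φ x = - ∫ x in Ioo 0 ℓ, g x * φ x

/-- The (class of the) function `f` has a representative that is continuous on `[0, ℓ]`, and
the value of that representative at `a` is `c`. For `f ∈ H¹(0, ℓ)` and an end point `a` this
says that the trace of `f` at `a` is `c`. -/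
def HasTrace (ℓ : ℝ) (f : L2 ℓ) (a c : ℝ) : Prop :=
  ∃ F : ℝ → ℝ, ContinuousOn F (Icc 0 ℓ) ∧ f =ᵐ[volume.restrict (Ioo 0 ℓ)] F ∧ F a = c

/-- The graph of the operator `A (u, v, z) = (½ u_xxx, - v_xxx, - h⁻¹ z_ρ)` on `H` with domain
`D(A) = {(u, v, z) : u, v ∈ H³(0, L) ∩ H¹₀(0, L), z ∈ H¹(0, 1), u_x(0) = 0, z(0) = u_x(L),
v_x(L) = α u_x(L) + β z(1)}`: the proposition says that `U ∈ D(A)` and `A U = W`. -/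
def GraphA (L α β h : ℝ) (U W : StateSpace L) : Prop :=
  ∃ (u₁ u₂ u₃ v₁ v₂ v₃ : L2 L) (z₁ : L2 1) (a b : ℝ),
    -- u and its derivatives
    IsWeakDeriv L U.1 u₁ ∧ IsWeakDeriv L u₁ u₂ ∧ IsWeakDeriv L u₂ u₃ ∧
    -- v and its derivatives
    IsWeakDeriv L U.2.1 v₁ ∧ IsWeakDeriv L v₁ v₂ ∧ IsWeakDeriv L v₂ v₃ ∧
    -- z and its derivative
    IsWeakDeriv 1 U.2.2 z₁ ∧
    -- homogeneous boundary conditions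
    HasTrace L U.1 0 0 ∧ HasTrace L U.1 L 0 ∧ HasTrace L U.2.1 0 0 ∧ HasTrace L U.2.1 L 0 ∧
    HasTrace L u₁ 0 0 ∧
    -- coupling: a = u_x(L) = z(0), b = z(1), v_x(L) = α a + β b
    HasTrace L u₁ L a ∧ HasTrace 1 U.2.2 0 a ∧ HasTrace 1 U.2.2 1 b ∧
    HasTrace L v₁ L (α * a + β * b) ∧
    -- the value of the operator
    W = ((1 / 2 : ℝ) • u₃, - v₃, - (h⁻¹ • z₁))

/-- `U = (u, v, z) ∈ C([0, T]; H)` is a (mild) solution of the Cauchy problem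
`U' = A U + (f₁, f₂, 0)`, `U(0) = U₀`, on `[0, T]`: for every `t ∈ [0, T]` one has
`∫₀ᵗ U ds ∈ D(A)` and `U(t) = U₀ + A ∫₀ᵗ U ds + ∫₀ᵗ (f₁, f₂, 0) ds`. -/
structure IsMildSolution (L T α β h : ℝ) (U₀ : StateSpace L) (f₁ f₂ : ℝ → L2 L)
    (U : ℝ → StateSpace L) : Prop where
  continuousOn : ContinuousOn U (Icc 0 T)
  initial : U 0 = U₀
  equation : ∀ t ∈ Icc 0 T,
    GraphA L α β h (∫ s in (0 : ℝ)..t, U s)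
      (U t - U₀ - ∫ s in (0 : ℝ)..t, ((f₁ s, f₂ s, 0) : StateSpace L))

/-- The function `g ∈ L²(0, T)` is the boundary trace `w(·, a)` of the time dependent function
`w`, in the sense that `(∫₀ᵗ w ds)(a) = ∫₀ᵗ g ds` for all `t ∈ [0, T]`. (The primitive in time
is regular enough in space to have a trace; `g` is unique up to null sets.) -/
def IsBoundaryValue (ℓ T : ℝ) (w : ℝ → L2 ℓ) (a : ℝ) (g : ℝ → ℝ) : Prop :=
  MemLp g 2 (volume.restrict (Ioo 0 T)) ∧
    ∀ t ∈ Icc 0 T, HasTrace ℓ (∫ s in (0 : ℝ)..t, w s) a (∫ s in (0 : ℝ)..t, g s)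

/-- The function `g ∈ L²(0, T)` is the boundary trace `w_x(·, a)` of the space derivative of
the time dependent function `w`, in the sense that `∂ₓ(∫₀ᵗ w ds)(a) = ∫₀ᵗ g ds` for all
`t ∈ [0, T]`. -/
def IsBoundarySlope (ℓ T : ℝ) (w : ℝ → L2 ℓ) (a : ℝ) (g : ℝ → ℝ) : Prop :=
  MemLp g 2 (volume.restrict (Ioo 0 T)) ∧
    ∀ t ∈ Icc 0 T, ∃ d : L2 ℓ, IsWeakDeriv ℓ (∫ s in (0 : ℝ)..t, w s) d ∧
      HasTrace ℓ d a (∫ s in (0 : ℝ)..t, g s)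

/-- `w ∈ L²(0, T; H¹(0, ℓ))`, with space derivative `w_x = p ∈ L²(0, T; L²(0, ℓ))`. -/
def IsL2H1 (ℓ T : ℝ) (w p : ℝ → L2 ℓ) : Prop :=
  MemLp w 2 (volume.restrict (Ioo 0 T)) ∧ MemLp p 2 (volume.restrict (Ioo 0 T)) ∧
    ∀ᵐ t ∂(volume.restrict (Ioo 0 T)), IsWeakDeriv ℓ (w t) (p t)

end HirotaSatsuma

end

/-!
# The delayed linear Hirota–Satsuma system

The equation `U' = A U + F` is solved through the bounded operator `B = A⁻¹` (`inverseA`), which is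
explicit: on an interval, `A U = W` is a pair of third-order boundary value problems and a
first-order one, solved by repeated integration. Since `GraphA U W ↔ U = B W`
(`graphA_inverseA`, `GraphA.eq_inverseA`), a mild solution is a continuous `U` with
`∫₀ᵗ U = B (U t - U₀ - ∫₀ᵗ F)`, and no unbounded operator is needed afterwards.

All estimates come from one weighted inner product (`energyForm`),
`∫ (K + L - x) u u' + ∫ (K + x) v v' + K β h ∫ z z'`. Integration by parts shows that `A` is
strictly dissipative for it: the constant part of the weights produces the boundary terms
`u_x(L)²` and `z(1)²`, with a good sign because `2 α² + 3/2 β < 1/2`, while the multipliers `L - x`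
and `x` produce `‖u_x‖²` and `‖v_x‖²`; the boundary terms which the multipliers create are absorbed
by a large `K`. With the observation `O W = (u_x(L), z(1), u_x, v_x)` of `(u, v, z) = B W`, this
reads `⟨W, B W⟩ ≤ - ½ ‖O W‖²` (`exists_energyForm_dissipative`).

The rest is an argument for a bounded injective operator `B` with `b W (B W) ≤ - κ ‖O W‖²`, where
`b` is a symmetric coercive form on a Banach space on which the Lax–Milgram theorem holds.
The operators `B - ε` are invertible, the range of `B` is dense, and the bounded operators
`(B - ε)⁻¹` are the Yosida approximations of `A`; the solutions of the corresponding linear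
equations converge uniformly when the data lie in the range of `B`
(`exists_mild_of_mem_range`). If `V` solves the equation with data `(B Y, B Φ)`, then `B V`
is a classical solution with data `(B² Y, B² Φ)` and `A (B V) = V`; the energy estimate applies to
differences of such solutions, so that both the states and the observations `O V` are Cauchy along
data approximating `(U₀, F)`, in `C([0, T])` and `L²(0, T)`. This gives existence, the traces and
the derivatives together with their bounds (`exists_mild_solution`).
Uniqueness is the energy estimate for `∫₀ᵗ U` (`eqOn_of_mild`).
-/

noncomputable section

namespace HirotaSatsuma

open Filter Topology

/-! ### Energy estimates and resolvents of dissipative operators -/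

section Abstract

variable {E : Type*} [NormedAddCommGroup E] [NormedSpace ℝ E]

theorem hasDerivAt_form {b : E →L[ℝ] E →L[ℝ] ℝ} (hsymm : ∀ x y, b x y = b y x)
    {X : ℝ → E} {X' : E} {t : ℝ} (hX : HasDerivAt X X' t) :
    HasDerivAt (fun s => b (X s) (X s)) (2 * b X' (X t)) t := by
  have h1 : HasDerivAt (fun s => b (X s)) (b X') t := b.hasFDerivAt.comp_hasDerivAt t hX
  have := h1.clm_apply hX
  have e : 2 * b X' (X t) = b X' (X t) + b (X t) X' := by rw [hsymm (X t) X']; ring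
  rw [e]; exact this

/-- The energy inequality for `X' = Z + F` with `b Z X ≤ -k`, in terms of any bound `M` of `‖X‖`. -/
theorem energy_le {b : E →L[ℝ] E →L[ℝ] ℝ} (hsymm : ∀ x y, b x y = b y x)
    {T M : ℝ} {X Z F : ℝ → E} {k : ℝ → ℝ} (hZ : Continuous Z) (hF : Continuous F)
    (hk : Continuous k) (hX : ∀ t, HasDerivAt X (Z t + F t) t)
    (hd : ∀ t ∈ Icc 0 T, b (Z t) (X t) ≤ - k t) (hM : ∀ t ∈ Icc 0 T, ‖X t‖ ≤ M)
    {t : ℝ} (ht : t ∈ Icc 0 T) :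
    b (X t) (X t) + 2 * ∫ s in (0 : ℝ)..t, k s ≤
      ‖b‖ * ‖X 0‖ ^ 2 + 2 * ‖b‖ * M * ∫ s in (0 : ℝ)..T, ‖F s‖ := by
  have hXc : Continuous X := continuous_iff_continuousAt.2 fun s => (hX s).continuousAt
  have hM0 : 0 ≤ M := (norm_nonneg _).trans (hM t ht)
  have hbZ : Continuous fun s => 2 * b (Z s + F s) (X s) := by fun_prop
  have h1 : ∫ s in (0 : ℝ)..t, 2 * b (Z s + F s) (X s) = b (X t) (X t) - b (X 0) (X 0) :=
    intervalIntegral.integral_eq_sub_of_hasDerivAt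
      (fun s _ => hasDerivAt_form hsymm (hX s)) (hbZ.intervalIntegrable _ _)
  have hR : Continuous fun s => 2 * ‖b‖ * M * ‖F s‖ - 2 * k s := by fun_prop
  have h2 : ∫ s in (0 : ℝ)..t, 2 * b (Z s + F s) (X s) ≤
      ∫ s in (0 : ℝ)..t, (2 * ‖b‖ * M * ‖F s‖ - 2 * k s) := by
    refine intervalIntegral.integral_mono_on ht.1 (hbZ.intervalIntegrable _ _)
      (hR.intervalIntegrable _ _) fun s hs => ?_
    have hs' : s ∈ Icc 0 T := ⟨hs.1, hs.2.trans ht.2⟩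
    have h3 : b (F s) (X s) ≤ ‖b‖ * M * ‖F s‖ := by
      calc b (F s) (X s) ≤ ‖b (F s) (X s)‖ := le_abs_self _
        _ ≤ ‖b‖ * ‖F s‖ * ‖X s‖ := b.le_opNorm₂ _ _
        _ ≤ ‖b‖ * ‖F s‖ * M := by gcongr; exact hM s hs'
        _ = _ := by ring
    have h4 := hd s hs'
    simp only [map_add, add_apply]
    linarith
  rw [h1, intervalIntegral.integral_sub (by apply Continuous.intervalIntegrable; fun_prop)
    (by apply Continuous.intervalIntegrable; fun_prop), intervalIntegral.integral_const_mul,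
    intervalIntegral.integral_const_mul] at h2
  have h5 : ∫ s in (0 : ℝ)..t, ‖F s‖ ≤ ∫ s in (0 : ℝ)..T, ‖F s‖ :=
    intervalIntegral.integral_mono_interval le_rfl ht.1 ht.2
      (Eventually.of_forall fun _ => norm_nonneg _) (hF.norm.intervalIntegrable _ _)
  have h6 : b (X 0) (X 0) ≤ ‖b‖ * ‖X 0‖ ^ 2 := by
    calc b (X 0) (X 0) ≤ ‖b (X 0) (X 0)‖ := le_abs_self _
        _ ≤ ‖b‖ * ‖X 0‖ * ‖X 0‖ := b.le_opNorm₂ _ _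
        _ = _ := by ring
  have h7 : 2 * ‖b‖ * M * ∫ s in (0 : ℝ)..t, ‖F s‖ ≤
    2 * ‖b‖ * M * ∫ s in (0 : ℝ)..T, ‖F s‖ := by gcongr
  linarith

/-- The bound of the solution and of the dissipation `k` by the data. The constant depends only on
the form: with `M = sup ‖X‖`, the energy inequality at a point where `M` is attained is a quadratic
inequality for `M`. -/
theorem exists_energy_bound {b : E →L[ℝ] E →L[ℝ] ℝ} (hsymm : ∀ x y, b x y = b y x)
    {c : ℝ} (hc : 0 < c) (hcoer : ∀ x, c * ‖x‖ ^ 2 ≤ b x x) :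
    ∃ C : ℝ, 0 < C ∧ ∀ (T : ℝ) (X Z F : ℝ → E) (k : ℝ → ℝ), 0 ≤ T → Continuous Z →
      Continuous F → Continuous k → (∀ t, HasDerivAt X (Z t + F t) t) →
      (∀ t ∈ Icc 0 T, b (Z t) (X t) ≤ - k t) → (∀ t ∈ Icc 0 T, 0 ≤ k t) →
      (∀ t ∈ Icc 0 T, ‖X t‖ ≤ C * (‖X 0‖ + ∫ s in (0 : ℝ)..T, ‖F s‖)) ∧
      ∫ s in (0 : ℝ)..T, k s ≤ C * (‖X 0‖ + ∫ s in (0 : ℝ)..T, ‖F s‖) ^ 2 := by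
  set r := ‖b‖ / c with hr
  have hr0 : 0 ≤ r := by positivity
  have hb : ‖b‖ = r * c := by rw [hr]; field_simp
  refine ⟨(1 + 3 * r) + (‖b‖ + ‖b‖ * (1 + 3 * r)), by positivity, ?_⟩
  intro T X Z F k hT hZ hF hk hX hd hk0
  have hXc : Continuous X := continuous_iff_continuousAt.2 fun s => (hX s).continuousAt
  obtain ⟨t₀, ht₀, hmax⟩ := isCompact_Icc.exists_isMaxOn (nonempty_Icc.2 hT)
    (hXc.norm.continuousOn (s := Icc 0 T))
  set M := ‖X t₀‖ with hMdef
  have hM : ∀ t ∈ Icc 0 T, ‖X t‖ ≤ M := fun t ht => hmax ht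
  have hM0 : 0 ≤ M := norm_nonneg _
  set S := ∫ s in (0 : ℝ)..T, ‖F s‖ with hS
  have hS0 : 0 ≤ S := intervalIntegral.integral_nonneg hT fun _ _ => norm_nonneg _
  have key := fun t ht => energy_le hsymm hZ hF hk hX hd hM (t := t) ht
  set N := ‖X 0‖ + S with hN
  have hX0 : 0 ≤ ‖X 0‖ := norm_nonneg _
  have hkint : ∀ t ∈ Icc 0 T, 0 ≤ ∫ s in (0 : ℝ)..t, k s := fun t ht =>
    intervalIntegral.integral_nonneg ht.1 fun s hs => hk0 s ⟨hs.1, hs.2.trans ht.2⟩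
  have h1 : M ^ 2 ≤ r * ‖X 0‖ ^ 2 + 2 * r * M * S := by
    have h2 := key t₀ ht₀
    have h3 := hcoer (X t₀)
    have h4 := hkint t₀ ht₀
    rw [hb] at h2
    rw [← mul_le_mul_iff_right₀ hc]
    nlinarith
  have h2 : M ≤ (1 + 3 * r) * N := by
    by_contra! hlt
    have hNM : N ≤ M := by nlinarith [mul_nonneg hr0 (add_nonneg hX0 hS0)]
    have hN0 : 0 ≤ N := by positivity
    have e1 : ‖X 0‖ ^ 2 ≤ N * M := by nlinarith
    have e2 : M * S ≤ M * N := by gcongr; linarith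
    have e3 : M ^ 2 ≤ 3 * r * N * M := by
      nlinarith [mul_le_mul_of_nonneg_left e1 hr0, mul_le_mul_of_nonneg_left e2 hr0]
    have hMpos : 0 < M := lt_of_le_of_lt (by positivity) hlt
    nlinarith
  have hN0 : 0 ≤ N := by positivity
  have hCb : 0 ≤ ‖b‖ + ‖b‖ * (1 + 3 * r) := by positivity
  constructor
  · intro t ht
    refine (hM t ht).trans (h2.trans ?_)
    nlinarith [mul_nonneg hCb hN0]
  · have h3 := key T ⟨hT, le_rfl⟩
    have h4 : 0 ≤ b (X T) (X T) := le_trans (by positivity) (hcoer (X T))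
    have e1 : ‖X 0‖ ^ 2 ≤ N ^ 2 := by gcongr; linarith
    have e2 : M * S ≤ (1 + 3 * r) * N * N := by
      refine mul_le_mul h2 (by linarith) hS0 (by positivity)
    have hb0 := norm_nonneg b
    have e3 := mul_le_mul_of_nonneg_left e1 hb0
    have e4 := mul_le_mul_of_nonneg_left e2 hb0
    nlinarith [mul_nonneg (show 0 ≤ 1 + 3 * r by positivity) (sq_nonneg N),
      mul_nonneg hb0 (sq_nonneg N)]

/-- Duhamel's formula for a bounded generator. -/
theorem exists_hasDerivAt_linear_ode [CompleteSpace E] (A : E →L[ℝ] E) (x : E) {F : ℝ → E}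
    (hF : Continuous F) :
    ∃ U : ℝ → E, U 0 = x ∧ ∀ t, HasDerivAt U (A (U t) + F t) t := by
  have hexp : ∀ t : ℝ, HasDerivAt (fun s : ℝ => NormedSpace.exp (s • A))
      (A * NormedSpace.exp (t • A)) t := fun t => hasDerivAt_exp_smul_const' A t
  have hexpn : Continuous fun s : ℝ => NormedSpace.exp (-s • A) := by
    have : Continuous fun s : ℝ => NormedSpace.exp (s • A) :=
      continuous_iff_continuousAt.2 fun s => (hexp s).continuousAt
    exact this.comp continuous_neg
  have hG : Continuous fun s : ℝ => NormedSpace.exp (-s • A) (F s) := hexpn.clm_apply hF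
  refine ⟨fun t => NormedSpace.exp (t • A)
    (x + ∫ s in (0 : ℝ)..t, NormedSpace.exp (-s • A) (F s)), by simp, fun t => ?_⟩
  have hI : HasDerivAt (fun t : ℝ => x + ∫ s in (0 : ℝ)..t, NormedSpace.exp (-s • A) (F s))
      (NormedSpace.exp (-t • A) (F t)) t :=
    (hG.integral_hasStrictDerivAt 0 t).hasDerivAt.const_add x
  have := (hexp t).clm_apply hI
  convert this using 1
  let _ : NormedAlgebra ℚ (E →L[ℝ] E) := NormedAlgebra.restrictScalars ℚ ℝ _
  have hinv : NormedSpace.exp (t • A) * NormedSpace.exp (-t • A) = 1 := by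
    rw [← NormedSpace.exp_add_of_commute]
    · simp
    · simp [Commute, SemiconjBy]
  have : (NormedSpace.exp (t • A)) ((NormedSpace.exp (-t • A)) (F t)) = F t := by
    rw [← mul_apply_eq_comp, hinv]; rfl
  rw [this]; rfl

/-- Every continuous linear functional is represented by every coercive bounded bilinear form. -/
def HasLaxMilgram (E : Type*) [NormedAddCommGroup E] [NormedSpace ℝ E] : Prop :=
  ∀ (b : E →L[ℝ] E →L[ℝ] ℝ) (c : ℝ), 0 < c → (∀ x, c * ‖x‖ ^ 2 ≤ b x x) →
    ∀ f : E →L[ℝ] ℝ, ∃ w, ∀ x, b w x = f x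

theorem hasLaxMilgram_of_hilbert {H : Type*} [NormedAddCommGroup H] [InnerProductSpace ℝ H]
    [CompleteSpace H] : HasLaxMilgram H := by
  intro b c hc hcoer f
  have hco : IsCoercive b := ⟨c, hc, fun u => by have := hcoer u; nlinarith⟩
  refine ⟨hco.continuousLinearEquivOfBilin.symm ((InnerProductSpace.toDual ℝ H).symm f),
    fun x => ?_⟩
  rw [← hco.continuousLinearEquivOfBilin_apply]
  simp

/-- The Lax–Milgram theorem does not see the choice among equivalent norms; this brings it to
products, whose norm is the maximum norm. -/
theorem HasLaxMilgram.of_equiv {H : Type*} [NormedAddCommGroup H] [NormedSpace ℝ H]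
    (hH : HasLaxMilgram H) (e : E ≃L[ℝ] H) : HasLaxMilgram E := by
  intro b c hc hcoer f
  set e' : H →L[ℝ] E := e.symm.toContinuousLinearMap
  set e'' : E →L[ℝ] H := e.toContinuousLinearMap
  obtain ⟨w, hw⟩ := hH (b.bilinearComp e' e') (c / (‖e''‖ + 1) ^ 2) (by positivity) (by
    intro x
    have h1 := hcoer (e' x)
    have h2 : ‖x‖ ≤ (‖e''‖ + 1) * ‖e' x‖ := by
      calc ‖x‖ = ‖e'' (e' x)‖ := by simp [e', e'']
        _ ≤ ‖e''‖ * ‖e' x‖ := e''.le_opNorm _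
        _ ≤ _ := by gcongr; linarith
    have h3 : ‖x‖ ^ 2 ≤ (‖e''‖ + 1) ^ 2 * ‖e' x‖ ^ 2 := by
      rw [← mul_pow]; gcongr
    refine le_trans ?_ h1
    rw [div_mul_eq_mul_div, div_le_iff₀ (by positivity)]
    calc c * ‖x‖ ^ 2 ≤ c * ((‖e''‖ + 1) ^ 2 * ‖e' x‖ ^ 2) := by gcongr
      _ = _ := by ring) (f ∘L e')
  exact ⟨e' w, fun x => by simpa [e'] using hw (e x)⟩

/-- For `B` dissipative with respect to `b`, all `B - ε` with `ε > 0` are invertible. -/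
theorem exists_inverse_sub [CompleteSpace E] (hLM : HasLaxMilgram E)
    {b : E →L[ℝ] E →L[ℝ] ℝ} {c : ℝ} (hc : 0 < c)
    (hcoer : ∀ x, c * ‖x‖ ^ 2 ≤ b x x) {B : E →L[ℝ] E} (hsymm : ∀ x y, b x y = b y x)
    (hB : ∀ x, b x (B x) ≤ 0)
    {ε : ℝ} (hε : 0 < ε) :
    ∃ R : E →L[ℝ] E, (∀ x, B (R x) - ε • R x = x) ∧ ∀ x, R (B x) - ε • R x = x := by
  set S : E →L[ℝ] E := ε • ContinuousLinearMap.id ℝ E - B with hS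
  have hSc : ∀ x, (ε * c) * ‖x‖ ^ 2 ≤ (b ∘L S) x x := by
    intro x
    have h1 := hcoer x
    have h2 := hB x
    have h3 : (b ∘L S) x x = ε * b x x - b x (B x) := by
      simp [hS, hsymm (B x) x]
    rw [h3]; nlinarith
  have hinj : Function.Injective S := by
    rw [injective_iff_map_eq_zero]
    intro x hx
    have h1 := hSc x
    simp only [ContinuousLinearMap.comp_apply, hx, map_zero, zero_apply] at h1
    have h2 : ‖x‖ ^ 2 ≤ 0 := by
      by_contra! h
      have := mul_pos (mul_pos hε hc) h
      linarith
    simpa using h2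
  have hsurj : Function.Surjective S := by
    intro y
    obtain ⟨x, hx⟩ := hLM (b ∘L S) (ε * c) (by positivity) hSc (b y)
    refine ⟨x, ?_⟩
    have h1 := hcoer (S x - y)
    have h2 : b (S x - y) (S x - y) = 0 := by
      have := hx (S x - y)
      simp only [ContinuousLinearMap.comp_apply] at this
      rw [map_sub b, sub_apply, this, sub_self]
    rw [h2] at h1
    have h2 : ‖S x - y‖ ^ 2 ≤ 0 := by
      by_contra! h
      have := mul_pos hc h
      linarith
    rw [← sub_eq_zero]
    simpa using h2
  set e := ContinuousLinearEquiv.ofBijective S (LinearMap.ker_eq_bot.2 hinj)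
    (LinearMap.range_eq_top.2 hsurj)
  have he : ∀ x, S (e.symm x) = x := fun x =>
    ContinuousLinearEquiv.ofBijective_apply_symm_apply S _ _ x
  have he' : ∀ x, e.symm (S x) = x := fun x =>
    ContinuousLinearEquiv.ofBijective_symm_apply_apply S _ _ x
  refine ⟨-e.symm.toContinuousLinearMap, fun x => ?_, fun x => ?_⟩
  · have := he x
    simp only [hS, sub_apply, smul_apply,
      ContinuousLinearMap.id_apply] at this
    simp only [neg_apply, ContinuousLinearEquiv.coe_coe, map_neg, smul_neg]
    rw [← sub_eq_zero] at this ⊢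
    rw [← this]; abel
  · have := he' x
    simp only [hS, sub_apply, smul_apply,
      ContinuousLinearMap.id_apply, map_sub, map_smul] at this
    simp only [neg_apply, ContinuousLinearEquiv.coe_coe, smul_neg]
    rw [← sub_eq_zero] at this ⊢
    rw [← this]; abel

/-- An injective dissipative operator has dense range: a functional that vanishes on the range is
represented by some `w` with `b w (B x) = 0` for all `x`, so that `w` minimizes `x ↦ -b x (B x)`. -/
theorem denseRange_of_dissipative (hLM : HasLaxMilgram E)
    {b : E →L[ℝ] E →L[ℝ] ℝ} {c : ℝ} (hc : 0 < c)
    (hcoer : ∀ x, c * ‖x‖ ^ 2 ≤ b x x) {B : E →L[ℝ] E} 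
    (hB : ∀ x, b x (B x) ≤ 0) (hinj : Function.Injective B) : DenseRange B := by
  by_contra hnd
  obtain ⟨x₀, hx₀⟩ : ∃ x, x ∉ B.range.topologicalClosure := by
    by_contra! h; exact hnd fun x => h x
  obtain ⟨f, hf, hfB⟩ : ∃ f : E →L[ℝ] ℝ, f x₀ ≠ 0 ∧ ∀ x, f (B x) = 0 := by
    obtain ⟨f, u, hfu, hux⟩ := geometric_hahn_banach_closed_point
      (B.range.topologicalClosure.convex) B.range.isClosed_topologicalClosure hx₀
    have hu : 0 < u := by simpa using hfu 0 (zero_mem _)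
    refine ⟨f, (hu.trans hux).ne', fun x => ?_⟩
    by_contra hne
    have h1 := hfu (B ((u / f (B x)) • x))
      (B.range.le_topologicalClosure (LinearMap.mem_range_self _ _))
    rw [map_smul, map_smul, smul_eq_mul, div_mul_cancel₀ _ hne] at h1
    exact lt_irrefl _ h1
  obtain ⟨w, hw⟩ := hLM b c hc hcoer f
  have hwB : ∀ x, b w (B x) = 0 := fun x => (hw _).trans (hfB x)
  have hBw : ∀ x, b x (B w) = 0 := by
    intro x
    have hq : ∀ t : ℝ, t * b x (B w) + t ^ 2 * b x (B x) ≤ 0 := by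
      intro t
      have := hB (w + t • x)
      simp only [map_add, map_smul, add_apply, smul_apply,
        hwB, smul_eq_mul, zero_add] at this
      linarith
    by_contra hne
    set p := b x (B w)
    set q := b x (B x)
    have hq0 : q ≤ 0 := hB x
    -- the quadratic polynomial is positive at this small multiple of `p`
    have h1 := hq (p / (1 - q))
    have h2 : 0 < 1 - q := by linarith
    have h3 : p / (1 - q) * p + (p / (1 - q)) ^ 2 * q = p ^ 2 / (1 - q) ^ 2 := by
      field_simp; ring
    rw [h3] at h1
    have : 0 < p ^ 2 / (1 - q) ^ 2 := by positivity
    linarith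
  have h1 := hcoer (B w)
  rw [hBw] at h1
  have h2 : ‖B w‖ ^ 2 ≤ 0 := by
    by_contra! h
    have := mul_pos hc h
    linarith
  have h3 : B w = 0 := by simpa using h2
  have h4 : w = 0 := hinj (by simpa using h3)
  apply hf
  rw [← hw, h4]; simp

end Abstract

/-! ### Uniform limits on a compact interval -/

section Limits

variable {E : Type*} [NormedAddCommGroup E]

/-- A uniform limit on `[0, T]`, extended to a continuous function on the line. -/
theorem exists_continuous_limit [CompleteSpace E] {T : ℝ} (hT : 0 ≤ T) {U : ℕ → ℝ → E}
    {δ : ℕ → ℝ} (hU : ∀ n, Continuous (U n)) (hδ : Tendsto δ atTop (𝓝 0))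
    (hc : ∀ n m, ∀ t ∈ Icc 0 T, ‖U n t - U m t‖ ≤ δ n + δ m) :
    ∃ V : ℝ → E, Continuous V ∧ ∀ n, ∀ t ∈ Icc 0 T, ‖U n t - V t‖ ≤ δ n := by
  have hcau : ∀ t ∈ Icc 0 T, ∃ v, Tendsto (fun n => U n t) atTop (𝓝 v) := by
    intro t ht
    apply cauchySeq_tendsto_of_complete
    rw [Metric.cauchySeq_iff]
    intro ε hε
    obtain ⟨N, hN⟩ := (hδ.eventually (gt_mem_nhds (half_pos hε))).exists_forall_of_atTop
    refine ⟨N, fun m hm n hn => ?_⟩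
    rw [dist_eq_norm]
    have := hc m n t ht
    linarith [hN m hm, hN n hn]
  choose! V hV using hcau
  have hle : ∀ n, ∀ t ∈ Icc 0 T, ‖U n t - V t‖ ≤ δ n := by
    intro n t ht
    have h1 : Tendsto (fun m => ‖U n t - U m t‖) atTop (𝓝 ‖U n t - V t‖) :=
      (tendsto_const_nhds.sub (hV t ht)).norm
    have h2 : Tendsto (fun m => δ n + δ m) atTop (𝓝 (δ n + 0)) := tendsto_const_nhds.add hδ
    simpa using le_of_tendsto_of_tendsto' h1 h2 fun m => hc n m t ht
  have hunif : TendstoUniformlyOn U V atTop (Icc 0 T) := by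
    rw [Metric.tendstoUniformlyOn_iff]
    intro ε hε
    filter_upwards [hδ.eventually (gt_mem_nhds hε)] with n hn t ht
    rw [dist_comm, dist_eq_norm]
    exact (hle n t ht).trans_lt hn
  have hVc : ContinuousOn V (Icc 0 T) :=
    hunif.continuousOn (Frequently.of_forall fun n => (hU n).continuousOn)
  refine ⟨fun t => V (projIcc 0 T hT t), ?_, fun n t ht => ?_⟩
  · exact hVc.comp_continuous (continuous_subtype_val.comp continuous_projIcc)
      fun t => (projIcc 0 T hT t).2
  · simpa [projIcc_of_mem hT ht] using hle n t ht

theorem tendsto_integral_of_norm_sub_le [NormedSpace ℝ E] {T : ℝ} {U : ℕ → ℝ → E} {V : ℝ → E}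
    {δ : ℕ → ℝ} (hU : ∀ n, Continuous (U n)) (hV : Continuous V) (hδ : Tendsto δ atTop (𝓝 0))
    (hc : ∀ n, ∀ t ∈ Icc 0 T, ‖U n t - V t‖ ≤ δ n) {t : ℝ} (ht : t ∈ Icc 0 T) :
    Tendsto (fun n => ∫ s in (0 : ℝ)..t, U n s) atTop (𝓝 (∫ s in (0 : ℝ)..t, V s)) := by
  rw [tendsto_iff_norm_sub_tendsto_zero]
  have h0 : Tendsto (fun n => δ n * |t - 0|) atTop (𝓝 0) := by
    simpa using hδ.mul_const |t - 0|
  refine squeeze_zero (fun _ => norm_nonneg _) (fun n => ?_) h0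
  rw [← intervalIntegral.integral_sub ((hU n).intervalIntegrable _ _) (hV.intervalIntegrable _ _)]
  refine intervalIntegral.norm_integral_le_of_norm_le_const fun s hs => hc n s ?_
  rw [uIoc_of_le ht.1] at hs
  exact ⟨hs.1.le, hs.2.trans ht.2⟩

theorem tendsto_of_norm_sub_le {T : ℝ} {U : ℕ → ℝ → E} {V : ℝ → E}
    {δ : ℕ → ℝ} (hδ : Tendsto δ atTop (𝓝 0))
    (hc : ∀ n, ∀ t ∈ Icc 0 T, ‖U n t - V t‖ ≤ δ n) {t : ℝ} (ht : t ∈ Icc 0 T) :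
    Tendsto (fun n => U n t) atTop (𝓝 (V t)) := by
  rw [tendsto_iff_norm_sub_tendsto_zero]
  exact squeeze_zero (fun _ => norm_nonneg _) (fun n => hc n t ht) hδ

end Limits

/-! ### Yosida approximation and uniqueness -/

section Yosida

variable {E : Type*} [NormedAddCommGroup E] [NormedSpace ℝ E]

/-- The resolvent bound, for `R = (B - ε)⁻¹`. -/
theorem norm_le_of_inverse_sub {b : E →L[ℝ] E →L[ℝ] ℝ} {c : ℝ} (hc : 0 < c)
    (hcoer : ∀ x, c * ‖x‖ ^ 2 ≤ b x x) {B R : E →L[ℝ] E} (hsymm : ∀ x y, b x y = b y x)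
    (hB : ∀ x, b x (B x) ≤ 0) {ε : ℝ} (hε : 0 < ε) (hR : ∀ x, B (R x) - ε • R x = x) (x : E) :
    ε * ‖R x‖ ≤ ‖b‖ / c * ‖x‖ := by
  set y := R x with hy
  have h1 : b x y = b y (B y) - ε * b y y := by
    conv_lhs => rw [← hR x, ← hy]
    simp [hsymm (B y) y]
  have h2 : -(‖b‖ * ‖x‖ * ‖y‖) ≤ b x y := neg_le_of_abs_le (b.le_opNorm₂ x y)
  have h3 := hB y
  have h4 := mul_le_mul_of_nonneg_left (hcoer y) hε.le
  have h5 : (c * (ε * ‖y‖)) * ‖y‖ ≤ (‖b‖ * ‖x‖) * ‖y‖ := by nlinarith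
  rcases (norm_nonneg y).eq_or_lt with h0 | h0
  · rw [← h0, mul_zero]; positivity
  · have := le_of_mul_le_mul_right h5 h0
    rw [div_mul_eq_mul_div, le_div_iff₀ hc]; linarith

/-- Existence of mild solutions for data `B Y`, `B Φ` with `Φ` continuous. With `R = (B - ε)⁻¹`, the
solutions of `U' = R U + B Φ` satisfy `U = B W - ε W` where `W = R U` is bounded uniformly in `ε`;
hence the energy of the difference of two of them is at most of the order of the sum of their
`ε`. -/
theorem exists_mild_of_mem_range [CompleteSpace E] (hLM : HasLaxMilgram E)
    {b : E →L[ℝ] E →L[ℝ] ℝ} {c : ℝ} (hc : 0 < c)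
    (hcoer : ∀ x, c * ‖x‖ ^ 2 ≤ b x x) {B : E →L[ℝ] E} (hsymm : ∀ x y, b x y = b y x)
    (hB : ∀ x, b x (B x) ≤ 0) {T : ℝ} (hT : 0 ≤ T) (Y : E) {Φ : ℝ → E} (hΦ : Continuous Φ) :
    ∃ V : ℝ → E, Continuous V ∧ ∀ t ∈ Icc 0 T,
      ∫ s in (0 : ℝ)..t, V s = B (V t - B Y - ∫ s in (0 : ℝ)..t, B (Φ s)) := by
  obtain ⟨C, hC, hbound⟩ := exists_energy_bound hsymm hc hcoer
  set ε : ℕ → ℝ := fun n => 1 / ((n : ℝ) + 1) with hεdef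
  have hε : ∀ n, 0 < ε n := fun n => by positivity
  have hε0 : Tendsto ε atTop (𝓝 0) := tendsto_one_div_add_atTop_nhds_zero_nat
  choose R hR hR' using fun n => exists_inverse_sub hLM hc hcoer hsymm hB (hε n)
  set K := 1 + ‖b‖ / c with hK
  have hRB : ∀ n x, ‖R n (B x)‖ ≤ K * ‖x‖ := by
    intro n x
    have h1 : R n (B x) = x + ε n • R n x := by rw [← sub_eq_iff_eq_add]; exact hR' n x
    rw [h1]
    refine (norm_add_le _ _).trans ?_
    rw [norm_smul, Real.norm_of_nonneg (hε n).le]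
    have := norm_le_of_inverse_sub hc hcoer hsymm hB (hε n) (hR n) x
    rw [hK, add_mul, one_mul]; linarith
  have hRd : ∀ n x, b (R n x) x ≤ 0 := by
    intro n x
    have h1 : b (R n x) x = b (R n x) (B (R n x)) - ε n * b (R n x) (R n x) := by
      have h0 := congrArg (b (R n x)) (hR n x)
      simp only [map_sub, map_smul, smul_eq_mul] at h0
      exact h0.symm
    have h2 : 0 ≤ b (R n x) (R n x) := le_trans (by positivity) (hcoer _)
    rw [h1]; nlinarith [hB (R n x), hε n]
  have hBΦ : Continuous fun s => B (Φ s) := B.continuous.comp hΦ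
  choose U hU0 hU using fun n => exists_hasDerivAt_linear_ode (R n) (B Y) hBΦ
  have hUc : ∀ n, Continuous (U n) := fun n =>
    continuous_iff_continuousAt.2 fun t => (hU n t).continuousAt
  set W : ℕ → ℝ → E := fun n t => R n (U n t) with hW
  have hWc : ∀ n, Continuous (W n) := fun n => (R n).continuous.comp (hUc n)
  have hUW : ∀ n t, U n t = B (W n t) - ε n • W n t := fun n t => (hR n _).symm
  -- the generators applied to the approximations stay bounded
  obtain ⟨M, hM0, hM⟩ : ∃ M, 0 ≤ M ∧ ∀ n, ∀ t ∈ Icc 0 T, ‖W n t‖ ≤ M := by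
    refine ⟨C * (K * ‖Y‖ + ∫ s in (0 : ℝ)..T, K * ‖Φ s‖), ?_, fun n t ht => ?_⟩
    · have : 0 ≤ ∫ s in (0 : ℝ)..T, K * ‖Φ s‖ :=
        intervalIntegral.integral_nonneg hT fun s _ => by positivity
      positivity
    have h1 := (hbound T (W n) (fun t => R n (W n t)) (fun t => R n (B (Φ t))) (fun _ => 0) hT
      ((R n).continuous.comp (hWc n)) ((R n).continuous.comp hBΦ) continuous_const
      (fun t => by
        have := (R n).hasFDerivAt.comp_hasDerivAt t (hU n t)
        rw [map_add] at this
        exact this)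
      (fun t _ => by simpa using hRd n (W n t)) (fun _ _ => le_rfl)).1 t ht
    refine h1.trans ?_
    have h2 : ‖W n 0‖ ≤ K * ‖Y‖ := by simpa [hW, hU0] using hRB n Y
    have h3 : ∫ s in (0 : ℝ)..T, ‖R n (B (Φ s))‖ ≤ ∫ s in (0 : ℝ)..T, K * ‖Φ s‖ := by
      refine intervalIntegral.integral_mono_on hT ?_ ?_ fun s _ => hRB n _
      · exact ((R n).continuous.comp hBΦ).norm.intervalIntegrable _ _
      · exact (hΦ.norm.const_mul K).intervalIntegrable _ _
    gcongr
  -- the approximations form a Cauchy sequence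
  set q : ℝ := 4 * T * (‖b‖ * M ^ 2) / c with hq
  have hq0 : 0 ≤ q := by positivity
  have hcau : ∀ n m, ∀ t ∈ Icc 0 T, ‖U n t - U m t‖ ≤ √(q * ε n) + √(q * ε m) := by
    intro n m t ht
    have hXc : Continuous fun t => U n t - U m t := (hUc n).sub (hUc m)
    obtain ⟨M', hM'⟩ := isCompact_Icc.exists_bound_of_continuousOn (s := Icc 0 T)
      hXc.continuousOn
    have h1 := energy_le hsymm (T := T) (M := M') (X := fun t => U n t - U m t)
      (Z := fun t => W n t - W m t) (F := fun _ => 0)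
      (k := fun _ => -(2 * (‖b‖ * M ^ 2) * (ε n + ε m)))
      ((hWc n).sub (hWc m)) continuous_const continuous_const
      (fun t => by simpa [hW] using (hU n t).fun_sub (hU m t))
      (fun t ht => by
        have e1 : U n t - U m t =
            B (W n t - W m t) - (ε n • W n t - ε m • W m t) := by
          rw [hUW n t, hUW m t, map_sub]; abel
        rw [neg_neg, e1, map_sub]
        have e2 := hB (W n t - W m t)
        have e3 : ‖W n t - W m t‖ ≤ 2 * M :=
          (norm_sub_le _ _).trans (by linarith [hM n t ht, hM m t ht])
        have e4 : ‖ε n • W n t - ε m • W m t‖ ≤ (ε n + ε m) * M := by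
          refine (norm_sub_le _ _).trans ?_
          rw [norm_smul, norm_smul, Real.norm_of_nonneg (hε n).le, Real.norm_of_nonneg (hε m).le]
          nlinarith [hM n t ht, hM m t ht, hε n, hε m]
        have e5 : -(b (W n t - W m t) (ε n • W n t - ε m • W m t)) ≤
            ‖b‖ * (2 * M) * ((ε n + ε m) * M) := by
          refine (neg_le_abs _).trans ((b.le_opNorm₂ _ _).trans ?_)
          gcongr
        calc _ ≤ ‖b‖ * (2 * M) * ((ε n + ε m) * M) := by linarith
          _ = _ := by ring) hM' ht
    simp only [hU0, sub_self, norm_zero, intervalIntegral.integral_const, smul_eq_mul,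
      mul_zero, sub_zero, ne_eq, OfNat.ofNat_ne_zero, not_false_eq_true, zero_pow, add_zero] at h1
    have h2 := hcoer (U n t - U m t)
    have h3 : ‖U n t - U m t‖ ^ 2 ≤ q * ε n + q * ε m := by
      have h4 : t * (2 * (‖b‖ * M ^ 2) * (ε n + ε m)) ≤ T * (2 * (‖b‖ * M ^ 2) * (ε n + ε m)) := by
        have := hε n; have := hε m
        exact mul_le_mul_of_nonneg_right ht.2 (by positivity)
      rw [hq, div_mul_eq_mul_div, div_mul_eq_mul_div, ← add_div, le_div_iff₀ hc]
      nlinarith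
    have h5 : ‖U n t - U m t‖ ≤ √(q * ε n + q * ε m) := Real.le_sqrt_of_sq_le h3
    refine h5.trans (Real.sqrt_le_iff.2 ⟨by positivity, ?_⟩)
    have e1 := Real.sq_sqrt (mul_nonneg hq0 (hε n).le)
    have e2 := Real.sq_sqrt (mul_nonneg hq0 (hε m).le)
    nlinarith [Real.sqrt_nonneg (q * ε n), Real.sqrt_nonneg (q * ε m)]
  have hδ0 : Tendsto (fun n => √(q * ε n)) atTop (𝓝 0) := by
    have : Tendsto (fun n => q * ε n) atTop (𝓝 0) := by simpa using hε0.const_mul q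
    simpa using this.sqrt
  obtain ⟨V, hVc, hV⟩ := exists_continuous_limit hT hUc hδ0 hcau
  refine ⟨V, hVc, fun t ht => ?_⟩
  have hl1 := tendsto_integral_of_norm_sub_le hUc hVc hδ0 hV ht
  have hl2 := tendsto_of_norm_sub_le hδ0 hV ht
  have heq : ∀ n, ∫ s in (0 : ℝ)..t, U n s =
      B (U n t - B Y - ∫ s in (0 : ℝ)..t, B (Φ s)) -
        ε n • (U n t - B Y - ∫ s in (0 : ℝ)..t, B (Φ s)) := by
    intro n
    have h1 : ∫ s in (0 : ℝ)..t, (W n s + B (Φ s)) = U n t - B Y := by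
      rw [← hU0 n]
      exact intervalIntegral.integral_eq_sub_of_hasDerivAt (fun s _ => hU n s)
        (((hWc n).add hBΦ).intervalIntegrable _ _)
    rw [intervalIntegral.integral_add ((hWc n).intervalIntegrable _ _)
      (hBΦ.intervalIntegrable _ _)] at h1
    rw [← h1, add_sub_cancel_right]
    simp_rw [hUW n]
    rw [intervalIntegral.integral_sub, intervalIntegral.integral_smul,
      B.intervalIntegral_comp_comm ((hWc n).intervalIntegrable _ _)]
    · exact (B.continuous.comp (hWc n)).intervalIntegrable _ _
    · exact ((hWc n).const_smul _).intervalIntegrable _ _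
  simp_rw [heq] at hl1
  have hl3 : Tendsto (fun n => U n t - B Y - ∫ s in (0 : ℝ)..t, B (Φ s)) atTop
      (𝓝 (V t - B Y - ∫ s in (0 : ℝ)..t, B (Φ s))) :=
    (hl2.sub tendsto_const_nhds).sub tendsto_const_nhds
  have hl4 := ((B.continuous.tendsto _).comp hl3).sub (hε0.smul hl3)
  rw [zero_smul, sub_zero] at hl4
  exact tendsto_nhds_unique hl1 hl4

/-- Uniqueness: the primitive `W` of the difference of two solutions satisfies `W = B W'`, so that
`b W W` does not increase. -/
theorem eqOn_of_mild [CompleteSpace E] {b : E →L[ℝ] E →L[ℝ] ℝ} {c : ℝ} (hc : 0 < c)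
    (hcoer : ∀ x, c * ‖x‖ ^ 2 ≤ b x x) {B : E →L[ℝ] E} (hsymm : ∀ x y, b x y = b y x)
    (hB : ∀ x, b x (B x) ≤ 0) (hinj : Function.Injective B) {T : ℝ} (hT : 0 ≤ T) {G U V : ℝ → E}
    (hUc : ContinuousOn U (Icc 0 T)) (hVc : ContinuousOn V (Icc 0 T))
    (hU : ∀ t ∈ Icc 0 T, ∫ s in (0 : ℝ)..t, U s = B (U t - G t))
    (hV : ∀ t ∈ Icc 0 T, ∫ s in (0 : ℝ)..t, V s = B (V t - G t)) :
    EqOn U V (Icc 0 T) := by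
  obtain ⟨C, hC, hbound⟩ := exists_energy_bound hsymm hc hcoer
  set D : ℝ → E := fun t => U (projIcc 0 T hT t) - V (projIcc 0 T hT t) with hD
  have hpc : Continuous fun t => (projIcc 0 T hT t : ℝ) :=
    continuous_subtype_val.comp continuous_projIcc
  have hDc : Continuous D :=
    (hUc.comp_continuous hpc fun t => (projIcc 0 T hT t).2).sub
      (hVc.comp_continuous hpc fun t => (projIcc 0 T hT t).2)
  have hDeq : ∀ t ∈ Icc 0 T, D t = U t - V t := fun t ht => by simp [hD, projIcc_of_mem hT ht]
  have hDB : ∀ t ∈ Icc 0 T, ∫ s in (0 : ℝ)..t, D s = B (D t) := by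
    intro t ht
    have hsub : uIcc 0 t ⊆ Icc 0 T := by rw [uIcc_of_le ht.1]; exact Icc_subset_Icc_right ht.2
    rw [intervalIntegral.integral_congr fun s hs => hDeq s (hsub hs),
      intervalIntegral.integral_sub (hUc.mono hsub).intervalIntegrable
        (hVc.mono hsub).intervalIntegrable, hU t ht, hV t ht, ← map_sub, hDeq t ht]
    congr 1; abel
  intro t ht
  have h1 := (hbound T (fun t => ∫ s in (0 : ℝ)..t, D s) D (fun _ => 0) (fun _ => 0) hT hDc
    continuous_const continuous_const
    (fun t => by simpa using (hDc.integral_hasStrictDerivAt 0 t).hasDerivAt)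
    (fun t ht => by simpa [hDB t ht] using hB (D t)) (fun _ _ => le_rfl)).1 t ht
  simp only [intervalIntegral.integral_same, norm_zero, intervalIntegral.integral_zero, add_zero,
    mul_zero, norm_le_zero_iff] at h1
  rw [hDB t ht] at h1
  have h2 : D t = 0 := hinj (by simpa using h1)
  rw [hDeq t ht] at h2
  exact sub_eq_zero.1 h2

end Yosida

/-! ### Norms in Bochner `L²` spaces -/

section Norms

variable {E : Type*} [NormedAddCommGroup E]

theorem norm_sq_eq_integral {α : Type*} [MeasurableSpace α] {μ : Measure α} (w : Lp E 2 μ) :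
    ‖w‖ ^ 2 = ∫ x, ‖w x‖ ^ 2 ∂μ := by
  have h := (Lp.memLp w).eLpNorm_eq_integral_rpow_norm two_ne_zero ENNReal.ofNat_ne_top
  have h0 : 0 ≤ ∫ x, ‖w x‖ ^ 2 ∂μ := integral_nonneg fun _ => by positivity
  simp only [ENNReal.toReal_ofNat, Real.rpow_ofNat] at h
  rw [Lp.norm_def, h, ENNReal.toReal_ofReal (by positivity), ← Real.rpow_natCast,
    ← Real.rpow_mul h0]
  norm_num

theorem norm_toLp_sq {α : Type*} [MeasurableSpace α] {μ : Measure α} {f : α → E}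
    (hf : MemLp f 2 μ) : ‖hf.toLp f‖ ^ 2 = ∫ x, ‖f x‖ ^ 2 ∂μ := by
  rw [norm_sq_eq_integral]
  refine integral_congr_ae ?_
  filter_upwards [hf.coeFn_toLp] with x hx
  rw [hx]

theorem memLp_of_continuous {f : ℝ → E} (hf : Continuous f) (T : ℝ) :
    MemLp f 2 (volume.restrict (Ioo 0 T)) := by
  obtain ⟨C, hC⟩ := isCompact_Icc.exists_bound_of_continuousOn (s := Icc 0 T) hf.continuousOn
  refine MemLp.of_bound hf.aestronglyMeasurable C ?_
  filter_upwards [ae_restrict_mem measurableSet_Ioo] with x hx using hC x (Ioo_subset_Icc_self hx)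

end Norms

/-! ### Approximation of sources and limits of observations -/

section Approximation

variable {E : Type*} [NormedAddCommGroup E] [NormedSpace ℝ E]

/-- Composition with an operator of dense range has dense range on `L¹`. -/
theorem denseRange_compLpL {α : Type*} [MeasurableSpace α] {μ : Measure α} {R : E →L[ℝ] E}
    (hR : DenseRange R) : DenseRange (R.compLpL 1 μ) := by
  intro f
  set S := (R.compLpL 1 μ).range.topologicalClosure with hS
  suffices h : f ∈ S from h
  induction f using Lp.induction (p := 1) (μ := μ) ENNReal.one_ne_top with
  | @indicatorConst c s hs hμs =>
    rw [Lp.simpleFunc.coe_indicatorConst]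
    refine Metric.mem_closure_iff.2 fun ε hε => ?_
    obtain ⟨y, hy⟩ := hR.exists_dist_lt c (ε := ε / (μ.real s + 1)) (by positivity)
    refine ⟨_, LinearMap.mem_range_self _ (indicatorConstLp 1 hs hμs.ne y), ?_⟩
    have h1 : R.compLpL 1 μ (indicatorConstLp 1 hs hμs.ne y) =
        indicatorConstLp 1 hs hμs.ne (R y) := by
      refine Lp.ext ?_
      filter_upwards [R.coeFn_compLpL (indicatorConstLp 1 hs hμs.ne y),
        indicatorConstLp_coeFn (p := 1) (hs := hs) (hμs := hμs.ne) (c := y),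
        indicatorConstLp_coeFn (p := 1) (hs := hs) (hμs := hμs.ne) (c := R y)] with x e1 e2 e3
      rw [e1, e2, e3]
      by_cases hx : x ∈ s <;> simp [hx]
    change dist _ (R.compLpL 1 μ (indicatorConstLp 1 hs hμs.ne y)) < ε
    rw [h1, dist_eq_norm, indicatorConstLp_sub]
    refine (norm_indicatorConstLp_le (p := 1)).trans_lt ?_
    rw [dist_eq_norm, lt_div_iff₀ (by positivity)] at hy
    simp only [ENNReal.toReal_one, div_one, Real.rpow_one]
    nlinarith [norm_nonneg (c - R y)]
  | add hf hg _ h1 h2 => exact S.add_mem h1 h2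
  | isClosed => exact (R.compLpL 1 μ).range.isClosed_topologicalClosure

theorem exists_continuous_integral_sub_le {R : E →L[ℝ] E} (hR : DenseRange R) {T : ℝ} (hT : 0 ≤ T)
    {F : ℝ → E} (hF : IntegrableOn F (Ioo 0 T)) {ε : ℝ} (hε : 0 < ε) :
    ∃ Φ : ℝ → E, Continuous Φ ∧ ∫ s in (0 : ℝ)..T, ‖R (Φ s) - F s‖ ≤ ε := by
  set μ := volume.restrict (Ioo 0 T) with hμ
  have hd : DenseRange (R.compLpL 1 μ ∘ BoundedContinuousFunction.toLp (E := E) 1 μ ℝ) :=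
    (denseRange_compLpL hR).comp
      (BoundedContinuousFunction.toLp_denseRange E μ ℝ ENNReal.one_ne_top)
      (R.compLpL 1 μ).continuous
  obtain ⟨Φ, hΦ⟩ := hd.exists_dist_lt ((memLp_one_iff_integrable.2 hF).toLp F) hε
  refine ⟨Φ, Φ.continuous, ?_⟩
  rw [dist_comm, dist_eq_norm, L1.norm_eq_integral_norm] at hΦ
  rw [intervalIntegral.integral_of_le hT, integral_Ioc_eq_integral_Ioo]
  refine le_trans (le_of_eq (integral_congr_ae ?_)) hΦ.le
  filter_upwards [Lp.coeFn_sub (R.compLpL 1 μ (BoundedContinuousFunction.toLp (E := E) 1 μ ℝ Φ))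
      ((memLp_one_iff_integrable.2 hF).toLp F),
    R.coeFn_compLpL (BoundedContinuousFunction.toLp (E := E) 1 μ ℝ Φ),
    BoundedContinuousFunction.coeFn_toLp 1 μ ℝ Φ,
    (memLp_one_iff_integrable.2 hF).coeFn_toLp] with x e1 e2 e3 e4
  rw [Function.comp_apply, e1, Pi.sub_apply, e2, e3, e4]

theorem tendsto_intervalIntegral_of_tendsto_Lp {T : ℝ}
    {w : ℕ → Lp E 2 (volume.restrict (Ioo 0 T))} {w' : Lp E 2 (volume.restrict (Ioo 0 T))}
    (h : Tendsto w atTop (𝓝 w')) {t : ℝ} (ht : t ∈ Icc 0 T) :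
    Tendsto (fun n => ∫ s in (0 : ℝ)..t, w n s) atTop (𝓝 (∫ s in (0 : ℝ)..t, w' s)) := by
  have hm : (volume.restrict (Ioo 0 T)).restrict (Ioo 0 t) = volume.restrict (Ioo 0 t) := by
    rw [Measure.restrict_restrict measurableSet_Ioo, inter_eq_left.2 (Ioo_subset_Ioo_right ht.2)]
  have hfin : IsFiniteMeasure (volume.restrict (Ioo 0 T)) := inferInstance
  revert w w'
  generalize volume.restrict (Ioo 0 T) = μ at *
  intro w w' h
  have hi : ∀ v : Lp E 2 μ, Integrable v μ := fun v => (Lp.memLp v).integrable one_le_two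
  have h1 : Tendsto (fun n => eLpNorm (⇑(w n) - ⇑w') 1 μ) atTop (𝓝 0) := by
    have h2 := (Lp.tendsto_Lp_iff_tendsto_eLpNorm' w w').1 h
    have h3 : Tendsto (fun n => eLpNorm (⇑(w n) - ⇑w') 2 μ *
        μ univ ^ (1 / (1 : ENNReal).toReal - 1 / (2 : ENNReal).toReal)) atTop (𝓝 0) := by
      have h4 := ENNReal.Tendsto.mul_const (b := μ univ ^
        (1 / (1 : ENNReal).toReal - 1 / (2 : ENNReal).toReal)) h2
          (Or.inr (ENNReal.rpow_ne_top_of_nonneg (by norm_num) (measure_ne_top _ _)))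
      simpa using h4
    refine tendsto_of_tendsto_of_tendsto_of_le_of_le tendsto_const_nhds h3 (fun _ => zero_le)
      fun n => ?_
    exact eLpNorm_le_eLpNorm_mul_rpow_measure_univ one_le_two
      ((Lp.aestronglyMeasurable _).sub (Lp.aestronglyMeasurable _))
  have h2 := tendsto_setIntegral_of_L1' (μ := μ) w' (Lp.aestronglyMeasurable w')
    (F := fun n => ⇑(w n)) (Eventually.of_forall fun n => hi _) h1 (Ioo 0 t)
  have h3 : ∀ v : Lp E 2 μ, ∫ s in (0 : ℝ)..t, v s = ∫ s in Ioo 0 t, v s ∂μ := by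
    intro v
    rw [intervalIntegral.integral_of_le ht.1, integral_Ioc_eq_integral_Ioo, hm]
  simpa only [h3] using h2

end Approximation

/-! ### Mild solutions for general data -/

section Solution

variable {E O : Type*} [NormedAddCommGroup E] [NormedSpace ℝ E] [CompleteSpace E]
  [NormedAddCommGroup O] [NormedSpace ℝ O] [CompleteSpace O]

/-- Existence of mild solutions for all data, with the bounds on the state and on the observation.
The observation `obs` stands for `Ob (A U)`, which makes no sense for a mild solution;
its primitive does. The last clause records that `(U t, obs t)` is a limit of pairs
`(B V, Ob V)`, so that closed relations between the two carry over. -/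
theorem exists_mild_solution (hLM : HasLaxMilgram E)
    {b : E →L[ℝ] E →L[ℝ] ℝ} {c : ℝ} (hc : 0 < c)
    (hcoer : ∀ x, c * ‖x‖ ^ 2 ≤ b x x) (hsymm : ∀ x y, b x y = b y x) {B : E →L[ℝ] E}
    (hinj : Function.Injective B) {κ : ℝ} (hκ : 0 < κ) {Ob : E →L[ℝ] O}
    (hB : ∀ x, b x (B x) ≤ - (κ * ‖Ob x‖ ^ 2)) {T : ℝ} (hT : 0 ≤ T) :
    ∃ C : ℝ, 0 < C ∧ ∀ (U₀ : E) (F : ℝ → E), IntegrableOn F (Ioo 0 T) →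
      ∃ (U : ℝ → E) (obs : ℝ → O), Continuous U ∧
        (∀ t ∈ Icc 0 T, ∫ s in (0 : ℝ)..t, U s = B (U t - U₀ - ∫ s in (0 : ℝ)..t, F s)) ∧
        MemLp obs 2 (volume.restrict (Ioo 0 T)) ∧
        (∀ t ∈ Icc 0 T, ∫ s in (0 : ℝ)..t, obs s = Ob (U t - U₀ - ∫ s in (0 : ℝ)..t, F s)) ∧
        (∀ t ∈ Icc 0 T, ‖U t‖ ≤ C * (‖U₀‖ + ∫ s in (0 : ℝ)..T, ‖F s‖)) ∧
        ∫ s in Ioo 0 T, ‖obs s‖ ^ 2 ≤ C * (‖U₀‖ + ∫ s in (0 : ℝ)..T, ‖F s‖) ^ 2 ∧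
        ∀ᵐ t ∂(volume.restrict (Ioo 0 T)),
          (U t, obs t) ∈ closure (range fun V => (B V, Ob V)) := by
  obtain ⟨C, hC, hbound⟩ := exists_energy_bound hsymm hc hcoer
  have hB0 : ∀ x, b x (B x) ≤ 0 := fun x => (hB x).trans (by
    have : 0 ≤ κ * ‖Ob x‖ ^ 2 := by positivity
    linarith)
  have hdr : DenseRange B := denseRange_of_dissipative hLM hc hcoer hB0 hinj
  have hdr2 : DenseRange (B ∘L B) := hdr.comp hdr B.continuous
  refine ⟨C + C / κ, by positivity, fun U₀ F hF => ?_⟩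
  have hFi : IntervalIntegrable F volume 0 T :=
    (intervalIntegrable_iff_integrableOn_Ioo_of_le hT).2 hF
  set e : ℕ → ℝ := fun n => 1 / ((n : ℝ) + 1) with he
  have hepos : ∀ n, 0 < e n := fun n => by positivity
  have he0 : Tendsto e atTop (𝓝 0) := tendsto_one_div_add_atTop_nhds_zero_nat
  choose Y hY using fun n => hdr2.exists_dist_lt U₀ (hepos n)
  choose Φ hΦc hΦ using fun n => exists_continuous_integral_sub_le hdr2 hT hF (hepos n)
  simp only [ContinuousLinearMap.comp_apply] at hY hΦ
  have hY' : ∀ n, ‖B (B (Y n)) - U₀‖ ≤ e n := fun n => by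
    rw [← dist_eq_norm, dist_comm]; exact (hY n).le
  have hBΦ : ∀ n, Continuous fun s => B (Φ n s) := fun n => B.continuous.comp (hΦc n)
  have hBBΦ : ∀ n, Continuous fun s => B (B (Φ n s)) := fun n => B.continuous.comp (hBΦ n)
  -- `B V n = u n` is a classical solution with `A (u n) = V n`
  choose V hVc hV using fun n =>
    exists_mild_of_mem_range hLM hc hcoer hsymm hB0 hT (Y n) (hΦc n)
  have hOV : ∀ n, Continuous fun t => Ob (V n t) := fun n => Ob.continuous.comp (hVc n)
  set u : ℕ → ℝ → E := fun n t =>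
    B (B (Y n)) + ∫ s in (0 : ℝ)..t, (V n s + B (B (Φ n s))) with hu
  have hud : ∀ n t, HasDerivAt (u n) (V n t + B (B (Φ n t))) t := fun n t =>
    (((hVc n).add (hBBΦ n)).integral_hasStrictDerivAt 0 t).hasDerivAt.const_add _
  have hu0 : ∀ n, u n 0 = B (B (Y n)) := fun n => by simp [hu]
  have huc : ∀ n, Continuous (u n) := fun n =>
    continuous_iff_continuousAt.2 fun t => (hud n t).continuousAt
  have hVint : ∀ n t, ∫ s in (0 : ℝ)..t, V n s =
      u n t - B (B (Y n)) - ∫ s in (0 : ℝ)..t, B (B (Φ n s)) := by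
    intro n t
    simp only [hu]
    rw [intervalIntegral.integral_add ((hVc n).intervalIntegrable _ _)
      ((hBBΦ n).intervalIntegrable _ _)]
    abel
  have huB : ∀ n, ∀ t ∈ Icc 0 T, u n t = B (V n t) := by
    intro n t ht
    have h1 := hV n t ht
    rw [hVint n t, map_sub, map_sub,
      ← B.intervalIntegral_comp_comm ((hBΦ n).intervalIntegrable _ _)] at h1
    exact sub_left_injective (sub_left_injective h1)
  -- the energy estimate for the approximations
  have hest : ∀ (N : ℝ) (v v' f : ℝ → E), Continuous v → Continuous f →
      (∀ t, HasDerivAt v' (v t + f t) t) → (∀ t ∈ Icc 0 T, v' t = B (v t)) →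
      ‖v' 0‖ + ∫ s in (0 : ℝ)..T, ‖f s‖ ≤ N → (∀ t ∈ Icc 0 T, ‖v' t‖ ≤ C * N) ∧
        ∫ s in Ioo 0 T, ‖Ob (v s)‖ ^ 2 ≤ C / κ * N ^ 2 := by
    intro N v v' f hv hf hv' hvB hN
    have hO : Continuous fun t => κ * ‖Ob (v t)‖ ^ 2 := by
      have := Ob.continuous.comp hv
      fun_prop
    have hnn : 0 ≤ ‖v' 0‖ + ∫ s in (0 : ℝ)..T, ‖f s‖ :=
      add_nonneg (norm_nonneg _) (intervalIntegral.integral_nonneg hT fun _ _ => norm_nonneg _)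
    obtain ⟨h1, h2⟩ := hbound T v' v f (fun t => κ * ‖Ob (v t)‖ ^ 2) hT hv hf hO hv'
      (fun t ht => by rw [hvB t ht]; exact hB _) (fun t _ => by positivity)
    refine ⟨fun t ht => (h1 t ht).trans (by gcongr), ?_⟩
    rw [intervalIntegral.integral_const_mul, intervalIntegral.integral_of_le hT,
      integral_Ioc_eq_integral_Ioo] at h2
    rw [div_mul_eq_mul_div, le_div_iff₀ hκ, mul_comm _ κ]
    refine h2.trans (by gcongr)
  have hdist : ∀ n m, ‖u n 0 - u m 0‖ + ∫ s in (0 : ℝ)..T, ‖B (B (Φ n s)) - B (B (Φ m s))‖ ≤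
      2 * e n + 2 * e m := by
    intro n m
    have h1 : ‖u n 0 - u m 0‖ ≤ e n + e m := by
      rw [hu0, hu0, show B (B (Y n)) - B (B (Y m)) =
        (B (B (Y n)) - U₀) - (B (B (Y m)) - U₀) by abel]
      exact (norm_sub_le _ _).trans (add_le_add (hY' n) (hY' m))
    have i1 : ∀ n, IntervalIntegrable (fun s => ‖B (B (Φ n s)) - F s‖) volume 0 T := fun n =>
      (((hBBΦ n).intervalIntegrable _ _).sub hFi).norm
    have h2 : ∫ s in (0 : ℝ)..T, ‖B (B (Φ n s)) - B (B (Φ m s))‖ ≤ e n + e m := by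
      calc _ ≤ ∫ s in (0 : ℝ)..T, (‖B (B (Φ n s)) - F s‖ + ‖B (B (Φ m s)) - F s‖) := by
            refine intervalIntegral.integral_mono_on hT
              (((hBBΦ n).sub (hBBΦ m)).norm.intervalIntegrable _ _) ((i1 n).add (i1 m))
              fun s _ => ?_
            rw [show B (B (Φ n s)) - B (B (Φ m s)) =
              (B (B (Φ n s)) - F s) - (B (B (Φ m s)) - F s) by abel]
            exact norm_sub_le _ _
        _ ≤ _ := by
            rw [intervalIntegral.integral_add (i1 n) (i1 m)]
            exact add_le_add (hΦ n) (hΦ m)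
    linarith
  set N := ‖U₀‖ + ∫ s in (0 : ℝ)..T, ‖F s‖ with hN
  have hN0 : 0 ≤ N :=
    add_nonneg (norm_nonneg _) (intervalIntegral.integral_nonneg hT fun _ _ => norm_nonneg _)
  have hsize : ∀ n, ‖u n 0‖ + ∫ s in (0 : ℝ)..T, ‖B (B (Φ n s))‖ ≤ N + 2 * e n := by
    intro n
    have h1 : ‖u n 0‖ ≤ ‖U₀‖ + e n := by
      rw [hu0]
      have := norm_le_norm_add_norm_sub' (B (B (Y n))) U₀
      linarith [hY' n]
    have i1 : IntervalIntegrable (fun s => ‖B (B (Φ n s)) - F s‖) volume 0 T :=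
      (((hBBΦ n).intervalIntegrable _ _).sub hFi).norm
    have h2 : ∫ s in (0 : ℝ)..T, ‖B (B (Φ n s))‖ ≤ (∫ s in (0 : ℝ)..T, ‖F s‖) + e n := by
      calc _ ≤ ∫ s in (0 : ℝ)..T, (‖F s‖ + ‖B (B (Φ n s)) - F s‖) := by
            refine intervalIntegral.integral_mono_on hT
              ((hBBΦ n).norm.intervalIntegrable _ _) (hFi.norm.add i1) fun s _ => ?_
            exact norm_le_norm_add_norm_sub' _ _
        _ ≤ _ := by
            rw [intervalIntegral.integral_add hFi.norm i1]
            linarith [hΦ n]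
    linarith
  have hpair := fun n m => hest (2 * e n + 2 * e m) (fun t => V n t - V m t)
    (fun t => u n t - u m t) (fun t => B (B (Φ n t)) - B (B (Φ m t))) ((hVc n).sub (hVc m))
    ((hBBΦ n).sub (hBBΦ m))
    (fun t => by
      have := (hud n t).fun_sub (hud m t)
      rwa [add_sub_add_comm] at this)
    (fun t ht => by rw [huB n t ht, huB m t ht, map_sub]) (hdist n m)
  have hsingle := fun n => hest (N + 2 * e n) (V n) (u n) (fun t => B (B (Φ n t))) (hVc n)
    (hBBΦ n) (hud n) (huB n) (hsize n)
  -- the limit of the states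
  have hδ0 : Tendsto (fun n => C * (2 * e n)) atTop (𝓝 0) := by
    simpa using (he0.const_mul 2).const_mul C
  obtain ⟨U, hUc, hU⟩ := exists_continuous_limit hT huc hδ0 fun n m t ht => by
    have := (hpair n m).1 t ht
    rwa [mul_add] at this
  -- the limit of the observations
  set μ := volume.restrict (Ioo 0 T) with hμ
  have hmem : ∀ n, MemLp (fun t => Ob (V n t)) 2 μ := fun n => memLp_of_continuous (hOV n) T
  set w : ℕ → Lp O 2 μ := fun n => (hmem n).toLp _ with hw
  have hwn : ∀ n, ‖w n‖ ≤ √(C / κ) * (N + 2 * e n) := by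
    intro n
    refine abs_le_of_sq_le_sq' ?_ (by have := hepos n; positivity) |>.2
    rw [mul_pow, Real.sq_sqrt (by positivity), norm_toLp_sq]
    exact (hsingle n).2
  have hwd : ∀ n m, ‖w n - w m‖ ≤ √(C / κ) * (2 * e n + 2 * e m) := by
    intro n m
    refine abs_le_of_sq_le_sq' ?_ (by have := hepos n; have := hepos m; positivity) |>.2
    rw [mul_pow, Real.sq_sqrt (by positivity), hw]
    simp only
    rw [← MemLp.toLp_sub, norm_toLp_sq]
    simpa using (hpair n m).2
  obtain ⟨obs, hobs⟩ : ∃ obs, Tendsto w atTop (𝓝 obs) := by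
    apply cauchySeq_tendsto_of_complete
    refine cauchySeq_of_le_tendsto_0' (fun n => √(C / κ) * (2 * e n + 2 * e n)) ?_ ?_
    · intro n m hnm
      rw [dist_eq_norm]
      refine (hwd n m).trans ?_
      have : e m ≤ e n := by simp only [he]; gcongr
      gcongr
    · simpa using ((he0.const_mul 2).add (he0.const_mul 2)).const_mul √(C / κ)
  have hUlim : ∀ t ∈ Icc 0 T, Tendsto (fun n => u n t) atTop (𝓝 (U t)) := fun t ht =>
    tendsto_of_norm_sub_le hδ0 hU ht
  have hdata : ∀ t ∈ Icc 0 T,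
      Tendsto (fun n => u n t - B (B (Y n)) - ∫ s in (0 : ℝ)..t, B (B (Φ n s))) atTop
        (𝓝 (U t - U₀ - ∫ s in (0 : ℝ)..t, F s)) := by
    intro t ht
    refine ((hUlim t ht).sub ?_).sub ?_
    · rw [tendsto_iff_norm_sub_tendsto_zero]
      exact squeeze_zero (fun _ => norm_nonneg _) hY' he0
    · rw [tendsto_iff_norm_sub_tendsto_zero]
      refine squeeze_zero (fun _ => norm_nonneg _) (fun n => ?_) he0
      have hFt : IntervalIntegrable F volume 0 t := hFi.mono_set (by
        rw [uIcc_of_le ht.1, uIcc_of_le hT]; exact Icc_subset_Icc_right ht.2)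
      rw [← intervalIntegral.integral_sub ((hBBΦ n).intervalIntegrable _ _) hFt]
      refine (intervalIntegral.norm_integral_le_integral_norm ht.1).trans
        (le_trans ?_ (hΦ n))
      exact intervalIntegral.integral_mono_interval le_rfl ht.1 ht.2
        (Eventually.of_forall fun _ => norm_nonneg _)
        (((hBBΦ n).intervalIntegrable _ _).sub hFi).norm
  refine ⟨U, obs, hUc, fun t ht => ?_, Lp.memLp obs, fun t ht => ?_, fun t ht => ?_, ?_, ?_⟩
  · have h1 := tendsto_integral_of_norm_sub_le huc hUc hδ0 hU ht
    refine tendsto_nhds_unique h1 (((B.continuous.tendsto _).comp (hdata t ht)).congr fun n => ?_)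
    rw [Function.comp_apply, ← hVint n t,
      ← B.intervalIntegral_comp_comm ((hVc n).intervalIntegrable _ _)]
    refine intervalIntegral.integral_congr fun s hs => (huB n s ?_).symm
    rw [uIcc_of_le ht.1] at hs
    exact ⟨hs.1, hs.2.trans ht.2⟩
  · have h1 := tendsto_intervalIntegral_of_tendsto_Lp hobs ht
    refine tendsto_nhds_unique h1
      (((Ob.continuous.tendsto _).comp (hdata t ht)).congr fun n => ?_)
    rw [Function.comp_apply, ← hVint n t,
      ← Ob.intervalIntegral_comp_comm ((hVc n).intervalIntegrable _ _)]
    rw [intervalIntegral.integral_of_le ht.1, intervalIntegral.integral_of_le ht.1,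
      integral_Ioc_eq_integral_Ioo, integral_Ioc_eq_integral_Ioo]
    refine integral_congr_ae ?_
    have := ae_mono (Measure.restrict_mono (Ioo_subset_Ioo_right ht.2) le_rfl)
      (hmem n).coeFn_toLp
    filter_upwards [this] with s hs using hs.symm
  · have h1 : ‖U t‖ ≤ C * N := by
      have h2 : Tendsto (fun n => C * (N + 2 * e n)) atTop (𝓝 (C * (N + 2 * 0))) :=
        ((he0.const_mul 2).const_add N).const_mul C
      rw [mul_zero, add_zero] at h2
      exact le_of_tendsto_of_tendsto' (hUlim t ht).norm h2 fun n => (hsingle n).1 t ht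
    have : 0 ≤ C / κ * N := by positivity
    linarith
  · have h1 : ‖obs‖ ≤ √(C / κ) * N := by
      have h2 : Tendsto (fun n => √(C / κ) * (N + 2 * e n)) atTop
          (𝓝 (√(C / κ) * (N + 2 * 0))) :=
        ((he0.const_mul 2).const_add N).const_mul _
      rw [mul_zero, add_zero] at h2
      exact le_of_tendsto_of_tendsto' hobs.norm h2 hwn
    rw [← norm_sq_eq_integral]
    calc ‖obs‖ ^ 2 ≤ (√(C / κ) * N) ^ 2 := by gcongr
      _ = C / κ * N ^ 2 := by rw [mul_pow, Real.sq_sqrt (by positivity)]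
      _ ≤ _ := by
        have : 0 ≤ C * N ^ 2 := by positivity
        linarith
  · obtain ⟨ns, hns, hae⟩ := (tendstoInMeasure_of_tendsto_Lp hobs).exists_seq_tendsto_ae
    have hall : ∀ᵐ t ∂μ, ∀ n, w n t = Ob (V n t) :=
      ae_all_iff.2 fun n => (hmem n).coeFn_toLp
    filter_upwards [hae, hall, ae_restrict_mem measurableSet_Ioo] with t h1 h2 h3
    have h4 := Ioo_subset_Icc_self h3
    refine mem_closure_of_tendsto (((hUlim t h4).comp hns.tendsto_atTop).prodMk_nhds h1)
      (Eventually.of_forall fun n => ⟨V (ns n) t, ?_⟩)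
    simp only [Function.comp_apply]
    rw [huB _ t h4, h2]

end Solution

/-! ### Classes of continuous functions in `L²(0, ℓ)` -/

section ContinuousClass

/-- The class in `L²(0, ℓ)` of a continuous function on the line. -/
def ofContinuous (ℓ : ℝ) (g : ℝ → ℝ) (hg : Continuous g) : L2 ℓ :=
  (memLp_of_continuous hg ℓ).toLp g

theorem coeFn_ofContinuous (ℓ : ℝ) {g : ℝ → ℝ} (hg : Continuous g) :
    ofContinuous ℓ g hg =ᵐ[volume.restrict (Ioo 0 ℓ)] g :=
  (memLp_of_continuous hg ℓ).coeFn_toLp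

theorem eq_ofContinuous {ℓ : ℝ} {f : L2 ℓ} {g : ℝ → ℝ} (hg : Continuous g)
    (h : f =ᵐ[volume.restrict (Ioo 0 ℓ)] g) : f = ofContinuous ℓ g hg :=
  Lp.ext (h.trans (coeFn_ofContinuous ℓ hg).symm)

theorem ofContinuous_add {ℓ : ℝ} {f g : ℝ → ℝ} (hf : Continuous f) (hg : Continuous g) :
    ofContinuous ℓ f hf + ofContinuous ℓ g hg = ofContinuous ℓ (fun x => f x + g x) (hf.add hg) :=
  (MemLp.toLp_add _ _).symm

theorem smul_ofContinuous {ℓ : ℝ} (c : ℝ) {f : ℝ → ℝ} (hf : Continuous f) :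
    c • ofContinuous ℓ f hf = ofContinuous ℓ (fun x => c * f x) (hf.const_mul c) :=
  (MemLp.toLp_const_smul c (memLp_of_continuous hf ℓ)).symm

theorem inner_ofContinuous_left {ℓ : ℝ} {g : ℝ → ℝ} (hg : Continuous g) (f : L2 ℓ) :
    inner ℝ (ofContinuous ℓ g hg) f = ∫ x in Ioo 0 ℓ, f x * g x := by
  rw [L2.inner_def]
  refine integral_congr_ae ?_
  filter_upwards [coeFn_ofContinuous ℓ hg] with x hx
  rw [hx]; rfl

theorem inner_ofContinuous {ℓ : ℝ} (hℓ : 0 ≤ ℓ) {f g : ℝ → ℝ} (hf : Continuous f)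
    (hg : Continuous g) :
    inner ℝ (ofContinuous ℓ f hf) (ofContinuous ℓ g hg) = ∫ x in (0 : ℝ)..ℓ, f x * g x := by
  rw [inner_ofContinuous_left, intervalIntegral.integral_of_le hℓ, integral_Ioc_eq_integral_Ioo]
  refine integral_congr_ae ?_
  filter_upwards [coeFn_ofContinuous ℓ hg] with x hx
  rw [hx, mul_comm]

/-- A closed property of elements of `L²(0, ℓ)` holds for all if it holds for continuous
functions. -/
theorem L2.induction_continuous {ℓ : ℝ} {p : L2 ℓ → Prop} (hp : IsClosed {f | p f})
    (h : ∀ g (hg : Continuous g), p (ofContinuous ℓ g hg)) (f : L2 ℓ) : p f := by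
  refine (BoundedContinuousFunction.toLp_denseRange ℝ (volume.restrict (Ioo 0 ℓ)) ℝ
    (p := 2) ENNReal.ofNat_ne_top).induction_on f hp fun g => ?_
  rw [eq_ofContinuous g.continuous (BoundedContinuousFunction.coeFn_toLp 2 _ ℝ g)]
  exact h _ _

end ContinuousClass

/-! ### The integration operator -/

section Primitive

theorem integral_norm_le (ℓ : ℝ) : ∃ C : ℝ, 0 ≤ C ∧ ∀ f : L2 ℓ,
    ∫ x in Ioo 0 ℓ, ‖f x‖ ≤ C * ‖f‖ := by
  set μ := volume.restrict (Ioo 0 ℓ)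
  set K := μ univ ^ (1 / (1 : ENNReal).toReal - 1 / (2 : ENNReal).toReal) with hK
  have hKt : K ≠ ⊤ := ENNReal.rpow_ne_top_of_nonneg (by norm_num) (measure_ne_top _ _)
  refine ⟨K.toReal, ENNReal.toReal_nonneg, fun f => ?_⟩
  have h := eLpNorm_le_eLpNorm_mul_rpow_measure_univ (μ := μ) one_le_two
    (Lp.aestronglyMeasurable f)
  rw [integral_norm_eq_lintegral_enorm (Lp.aestronglyMeasurable f),
    ← eLpNorm_one_eq_lintegral_enorm, mul_comm, Lp.norm_def, ← ENNReal.toReal_mul]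
  exact ENNReal.toReal_mono (ENNReal.mul_ne_top (Lp.eLpNorm_ne_top f) hKt) h

theorem integrableOn_L2 {ℓ : ℝ} (f : L2 ℓ) : IntegrableOn f (Ioo 0 ℓ) :=
  (Lp.memLp f).integrable one_le_two

theorem intervalIntegrable_L2 {ℓ : ℝ} (f : L2 ℓ) {x : ℝ} (hx : x ∈ Icc 0 ℓ) :
    IntervalIntegrable f volume 0 x :=
  (intervalIntegrable_iff_integrableOn_Ioo_of_le hx.1).2
    ((integrableOn_L2 f).mono_set (Ioo_subset_Ioo_right hx.2))

theorem continuousOn_primitive {ℓ : ℝ} (f : L2 ℓ) :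
    ContinuousOn (fun x => ∫ y in (0 : ℝ)..x, f y) (Icc 0 ℓ) := by
  rcases lt_or_ge ℓ 0 with h | h
  · simp [Icc_eq_empty h.not_ge]
  · have h1 : IntegrableOn f (uIcc 0 ℓ) := by
      rw [uIcc_of_le h, integrableOn_Icc_iff_integrableOn_Ioo]; exact integrableOn_L2 f
    have := intervalIntegral.continuousOn_primitive_interval h1
    rwa [uIcc_of_le h] at this

theorem norm_primitive_le {ℓ : ℝ} (f : L2 ℓ) {x : ℝ} (hx : x ∈ Icc 0 ℓ) :
    ‖∫ y in (0 : ℝ)..x, f y‖ ≤ ∫ y in Ioo 0 ℓ, ‖f y‖ := by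
  refine (intervalIntegral.norm_integral_le_integral_norm hx.1).trans ?_
  rw [intervalIntegral.integral_of_le hx.1, integral_Ioc_eq_integral_Ioo]
  exact setIntegral_mono_set (integrableOn_L2 f).norm
    (Eventually.of_forall fun _ => norm_nonneg _) (Ioo_subset_Ioo_right hx.2).eventuallyLE

theorem memLp_primitive {ℓ : ℝ} (f : L2 ℓ) :
    MemLp (fun x => ∫ y in (0 : ℝ)..x, f y) 2 (volume.restrict (Ioo 0 ℓ)) := by
  refine MemLp.of_bound (((continuousOn_primitive f).mono
    Ioo_subset_Icc_self).aestronglyMeasurable measurableSet_Ioo) (∫ y in Ioo 0 ℓ, ‖f y‖) ?_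
  filter_upwards [ae_restrict_mem measurableSet_Ioo] with x hx using
    norm_primitive_le f (Ioo_subset_Icc_self hx)

/-- The operator `f ↦ (x ↦ ∫₀ˣ f)` on `L²(0, ℓ)`. -/
def primitive (ℓ : ℝ) : L2 ℓ →L[ℝ] L2 ℓ :=
  LinearMap.mkContinuousOfExistsBound
    { toFun := fun f => (memLp_primitive f).toLp _
      map_add' := fun f g => by
        rw [← MemLp.toLp_add]
        refine MemLp.toLp_congr _ _ ?_
        filter_upwards [ae_restrict_mem measurableSet_Ioo] with x hx
        have hx' := Ioo_subset_Icc_self hx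
        rw [Pi.add_apply, ← intervalIntegral.integral_add (intervalIntegrable_L2 f hx')
          (intervalIntegrable_L2 g hx'), intervalIntegral.integral_of_le hx'.1,
          intervalIntegral.integral_of_le hx'.1, integral_Ioc_eq_integral_Ioo,
          integral_Ioc_eq_integral_Ioo]
        exact integral_congr_ae (ae_mono (Measure.restrict_mono
          (Ioo_subset_Ioo_right hx'.2) le_rfl) (Lp.coeFn_add f g))
      map_smul' := fun c f => by
        rw [RingHom.id_apply, ← MemLp.toLp_const_smul]
        refine MemLp.toLp_congr _ _ ?_
        filter_upwards [ae_restrict_mem measurableSet_Ioo] with x hx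
        have hx' := Ioo_subset_Icc_self hx
        rw [Pi.smul_apply, ← intervalIntegral.integral_smul,
          intervalIntegral.integral_of_le hx'.1,
          intervalIntegral.integral_of_le hx'.1, integral_Ioc_eq_integral_Ioo,
          integral_Ioc_eq_integral_Ioo]
        exact integral_congr_ae (ae_mono (Measure.restrict_mono
          (Ioo_subset_Ioo_right hx'.2) le_rfl) (Lp.coeFn_smul c f)) }
    (by
      obtain ⟨C, hC, h⟩ := integral_norm_le ℓ
      refine ⟨(measureUnivNNReal (volume.restrict (Ioo 0 ℓ)) : ℝ) ^ (2 : ENNReal).toReal⁻¹ * C,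
        fun f => ?_⟩
      rw [mul_assoc]
      refine Lp.norm_le_of_ae_bound (by positivity) ?_
      filter_upwards [(memLp_primitive f).coeFn_toLp, ae_restrict_mem measurableSet_Ioo]
        with x e1 hx
      change ‖((memLp_primitive f).toLp _ : L2 ℓ) x‖ ≤ _
      rw [e1]
      exact (norm_primitive_le f (Ioo_subset_Icc_self hx)).trans (h f))

theorem coeFn_primitive {ℓ : ℝ} (f : L2 ℓ) :
    primitive ℓ f =ᵐ[volume.restrict (Ioo 0 ℓ)] fun x => ∫ y in (0 : ℝ)..x, f y :=
  (memLp_primitive f).coeFn_toLp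

theorem hasDerivAt_integral {g : ℝ → ℝ} (hg : Continuous g) (x : ℝ) :
    HasDerivAt (fun x => ∫ y in (0 : ℝ)..x, g y) (g x) x :=
  (hg.integral_hasStrictDerivAt 0 x).hasDerivAt

theorem continuous_integral {g : ℝ → ℝ} (hg : Continuous g) :
    Continuous fun x => ∫ y in (0 : ℝ)..x, g y :=
  continuous_iff_continuousAt.2 fun x => (hasDerivAt_integral hg x).continuousAt

theorem integral_ofContinuous {ℓ : ℝ} {g : ℝ → ℝ} (hg : Continuous g) {x : ℝ} (hx : x ∈ Icc 0 ℓ) :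
    ∫ y in (0 : ℝ)..x, ofContinuous ℓ g hg y = ∫ y in (0 : ℝ)..x, g y := by
  rw [intervalIntegral.integral_of_le hx.1, intervalIntegral.integral_of_le hx.1,
    integral_Ioc_eq_integral_Ioo, integral_Ioc_eq_integral_Ioo]
  exact integral_congr_ae (ae_mono (Measure.restrict_mono
    (Ioo_subset_Ioo_right hx.2) le_rfl) (coeFn_ofContinuous ℓ hg))

theorem primitive_ofContinuous {ℓ : ℝ} {g : ℝ → ℝ} (hg : Continuous g) :
    primitive ℓ (ofContinuous ℓ g hg) =
      ofContinuous ℓ (fun x => ∫ y in (0 : ℝ)..x, g y) (continuous_integral hg) := by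
  refine eq_ofContinuous _ ?_
  filter_upwards [coeFn_primitive (ofContinuous ℓ g hg), ae_restrict_mem measurableSet_Ioo]
    with x e1 hx
  rw [e1, integral_ofContinuous hg (Ioo_subset_Icc_self hx)]

/-- The constant function `1` in `L²(0, ℓ)`. -/
def oneL2 (ℓ : ℝ) : L2 ℓ := ofContinuous ℓ (fun _ => 1) continuous_const

/-- The functional `f ↦ ∫₀ˡ f` on `L²(0, ℓ)`. -/
def total (ℓ : ℝ) : L2 ℓ →L[ℝ] ℝ := innerSL ℝ (oneL2 ℓ)

theorem total_apply {ℓ : ℝ} (hℓ : 0 ≤ ℓ) (f : L2 ℓ) : total ℓ f = ∫ x in (0 : ℝ)..ℓ, f x := by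
  rw [intervalIntegral.integral_of_le hℓ, integral_Ioc_eq_integral_Ioo]
  have h := inner_ofContinuous_left (ℓ := ℓ) (continuous_const (y := (1 : ℝ))) f
  simp only [mul_one] at h
  exact h

theorem total_ofContinuous {ℓ : ℝ} (hℓ : 0 ≤ ℓ) {g : ℝ → ℝ} (hg : Continuous g) :
    total ℓ (ofContinuous ℓ g hg) = ∫ x in (0 : ℝ)..ℓ, g x := by
  rw [total_apply hℓ, integral_ofContinuous hg ⟨hℓ, le_rfl⟩]

end Primitive

/-! ### Traces -/

section Trace

variable {ℓ : ℝ}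

theorem HasTrace.add {f g : L2 ℓ} {a c d : ℝ} (hf : HasTrace ℓ f a c) (hg : HasTrace ℓ g a d) :
    HasTrace ℓ (f + g) a (c + d) := by
  obtain ⟨F, hF, hfF, rfl⟩ := hf
  obtain ⟨G, hG, hgG, rfl⟩ := hg
  exact ⟨F + G, hF.add hG, (Lp.coeFn_add f g).trans (hfF.add hgG), rfl⟩

theorem HasTrace.smul {f : L2 ℓ} {a c : ℝ} (r : ℝ) (hf : HasTrace ℓ f a c) :
    HasTrace ℓ (r • f) a (r * c) := by
  obtain ⟨F, hF, hfF, rfl⟩ := hf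
  exact ⟨r • F, hF.const_smul r, (Lp.coeFn_smul r f).trans (hfF.const_smul r), rfl⟩

theorem HasTrace.unique (hℓ : 0 < ℓ) {f : L2 ℓ} {a c d : ℝ} (ha : a ∈ Icc 0 ℓ)
    (hc : HasTrace ℓ f a c) (hd : HasTrace ℓ f a d) : c = d := by
  obtain ⟨F, hF, hfF, rfl⟩ := hc
  obtain ⟨G, hG, hfG, rfl⟩ := hd
  refine Measure.eqOn_Icc_of_ae_eq volume hℓ.ne ?_ hF hG ha
  rw [restrict_Ioo_eq_restrict_Icc.symm]
  exact hfF.symm.trans hfG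

theorem hasTrace_ofContinuous {g : ℝ → ℝ} (hg : Continuous g) (a : ℝ) :
    HasTrace ℓ (ofContinuous ℓ g hg) a (g a) :=
  ⟨g, hg.continuousOn, coeFn_ofContinuous ℓ hg, rfl⟩

theorem hasTrace_one (a : ℝ) : HasTrace ℓ (oneL2 ℓ) a 1 := hasTrace_ofContinuous _ a

theorem hasTrace_primitive_left (f : L2 ℓ) : HasTrace ℓ (primitive ℓ f) 0 0 :=
  ⟨_, continuousOn_primitive f, coeFn_primitive f, by simp⟩

theorem hasTrace_primitive_right (hℓ : 0 ≤ ℓ) (f : L2 ℓ) :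
    HasTrace ℓ (primitive ℓ f) ℓ (total ℓ f) :=
  ⟨_, continuousOn_primitive f, coeFn_primitive f, (total_apply hℓ f).symm⟩

end Trace

/-! ### Weak derivatives -/

section WeakDeriv

variable {ℓ : ℝ}

/-- Weak derivatives in terms of inner products, which shows that the relation is linear and
closed. -/
theorem isWeakDeriv_iff_inner {f g : L2 ℓ} : IsWeakDeriv ℓ f g ↔
    ∀ (φ : ℝ → ℝ) (hφ : ContDiff ℝ ∞ φ), HasCompactSupport φ → tsupport φ ⊆ Ioo 0 ℓ →
      inner ℝ (ofContinuous ℓ (deriv φ) (hφ.continuous_deriv (by simp))) f =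
        - inner ℝ (ofContinuous ℓ φ hφ.continuous) g := by
  simp only [inner_ofContinuous_left]; rfl

theorem IsWeakDeriv.add {f g f' g' : L2 ℓ} (hf : IsWeakDeriv ℓ f f') (hg : IsWeakDeriv ℓ g g') :
    IsWeakDeriv ℓ (f + g) (f' + g') := by
  rw [isWeakDeriv_iff_inner] at *
  intro φ h1 h2 h3
  rw [inner_add_right, inner_add_right, hf φ h1 h2 h3, hg φ h1 h2 h3]; ring

theorem IsWeakDeriv.smul {f f' : L2 ℓ} (c : ℝ) (hf : IsWeakDeriv ℓ f f') :
    IsWeakDeriv ℓ (c • f) (c • f') := by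
  rw [isWeakDeriv_iff_inner] at *
  intro φ h1 h2 h3
  rw [inner_smul_right, inner_smul_right, hf φ h1 h2 h3]; ring

theorem isClosed_isWeakDeriv : IsClosed {p : L2 ℓ × L2 ℓ | IsWeakDeriv ℓ p.1 p.2} := by
  simp only [isWeakDeriv_iff_inner, ofPred_forall]
  refine isClosed_iInter fun φ => isClosed_iInter fun h1 => isClosed_iInter fun _ =>
    isClosed_iInter fun _ => isClosed_eq (by fun_prop) (by fun_prop)

theorem isWeakDeriv_of_hasDerivAt (hℓ : 0 ≤ ℓ) {F f : ℝ → ℝ} (hF : Continuous F)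
    (hf : Continuous f) (h : ∀ x, HasDerivAt F (f x) x) :
    IsWeakDeriv ℓ (ofContinuous ℓ F hF) (ofContinuous ℓ f hf) := by
  rw [isWeakDeriv_iff_inner]
  intro φ h1 h2 h3
  have hd : Continuous (deriv φ) := h1.continuous_deriv (by simp)
  rw [inner_ofContinuous hℓ, inner_ofContinuous hℓ]
  have h0 : φ 0 = 0 := image_eq_zero_of_notMem_tsupport fun h => lt_irrefl _ (h3 h).1
  have hL : φ ℓ = 0 := image_eq_zero_of_notMem_tsupport fun h => lt_irrefl _ (h3 h).2
  have := intervalIntegral.integral_mul_deriv_eq_deriv_mul (a := 0) (b := ℓ) (u := F) (u' := f)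
    (v := φ) (v' := deriv φ) (fun x _ => h x)
    (fun x _ => (h1.differentiable (by simp) x).hasDerivAt)
    (hf.intervalIntegrable _ _) (hd.intervalIntegrable _ _)
  rw [h0, hL, mul_zero, mul_zero, sub_zero, zero_sub] at this
  simpa only [mul_comm] using this

theorem isWeakDeriv_primitive (hℓ : 0 ≤ ℓ) (f : L2 ℓ) : IsWeakDeriv ℓ (primitive ℓ f) f := by
  refine L2.induction_continuous (p := fun f => IsWeakDeriv ℓ (primitive ℓ f) f) ?_ ?_ f
  · exact isClosed_isWeakDeriv.preimage ((primitive ℓ).continuous.prodMk continuous_id)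
  · intro g hg
    rw [primitive_ofContinuous]
    exact isWeakDeriv_of_hasDerivAt hℓ _ hg (hasDerivAt_integral hg)

theorem isWeakDeriv_one (hℓ : 0 ≤ ℓ) : IsWeakDeriv ℓ (oneL2 ℓ) 0 := by
  have h := isWeakDeriv_of_hasDerivAt hℓ (continuous_const (y := (1 : ℝ)))
    (continuous_const (y := (0 : ℝ))) fun x => hasDerivAt_const x 1
  have h0 : ofContinuous ℓ (fun _ => (0 : ℝ)) continuous_const = 0 :=
    (eq_ofContinuous _ (Lp.coeFn_zero ℝ 2 _)).symm
  rwa [h0] at h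

/-- A test function with vanishing integral has a primitive that is again a test function. -/
theorem exists_test_primitive {θ : ℝ → ℝ} (hθ : ContDiff ℝ ∞ θ) {a b : ℝ} (ha : 0 < a)
    (hb : b < ℓ) (hsupp : Function.support θ ⊆ Icc a b) (hint : ∫ x, θ x = 0) :
    ∃ φ : ℝ → ℝ, ContDiff ℝ ∞ φ ∧ HasCompactSupport φ ∧ tsupport φ ⊆ Ioo 0 ℓ ∧ deriv φ = θ := by
  have hd := hasDerivAt_integral hθ.continuous
  have hderiv : deriv (fun x => ∫ y in (0 : ℝ)..x, θ y) = θ := funext fun x => (hd x).deriv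
  have hsup : Function.support (fun x => ∫ y in (0 : ℝ)..x, θ y) ⊆ Icc a b := by
    intro x hx
    by_contra hxab
    apply hx
    rw [mem_Icc, not_and_or, not_le, not_le] at hxab
    rcases hxab with h | h
    · have : ∫ y in (0 : ℝ)..x, θ y = ∫ y in (0 : ℝ)..x, (0 : ℝ) := by
        refine intervalIntegral.integral_congr fun y hy => ?_
        by_contra hne
        have := (hsupp hne).1
        have h2 : y ≤ max 0 x := hy.2
        rcases max_cases 0 x with ⟨e, _⟩ | ⟨e, _⟩ <;> rw [e] at h2 <;> linarith
      simpa using this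
    · refine Eq.trans ?_ hint
      refine intervalIntegral.integral_eq_integral_of_support_subset fun y hy => ?_
      have := hsupp hy
      exact ⟨ha.trans_le this.1, this.2.trans h.le⟩
  have hts : tsupport (fun x => ∫ y in (0 : ℝ)..x, θ y) ⊆ Icc a b :=
    closure_minimal hsup isClosed_Icc
  refine ⟨_, ?_, HasCompactSupport.of_support_subset_isCompact isCompact_Icc hsup,
    hts.trans fun x hx => ⟨ha.trans_le hx.1, hx.2.trans_lt hb⟩, hderiv⟩
  rw [contDiff_infty_iff_deriv, hderiv]
  exact ⟨fun x => (hd x).differentiableAt, hθ⟩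

/-- The lemma of du Bois-Reymond: a function with vanishing weak derivative is constant. -/
theorem IsWeakDeriv.eq_const (hℓ : 0 < ℓ) {f : L2 ℓ} (hf : IsWeakDeriv ℓ f 0) :
    ∃ c : ℝ, f = c • oneL2 ℓ := by
  let η₀ : ContDiffBump (ℓ / 2) := ⟨ℓ / 8, ℓ / 4, by positivity, by linarith⟩
  set η : ℝ → ℝ := η₀.normed volume with hη
  have hηs : ContDiff ℝ ∞ η := η₀.contDiff_normed
  have hηsupp : tsupport η ⊆ Icc (ℓ / 4) (3 * ℓ / 4) := by
    rw [hη, η₀.tsupport_normed_eq, Real.closedBall_eq_Icc]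
    refine Icc_subset_Icc ?_ ?_ <;> simp only [η₀] <;> linarith
  have hηc : HasCompactSupport η := η₀.hasCompactSupport_normed
  have hη1 : ∫ x, η x = 1 := η₀.integral_normed
  -- testing with the primitive of `ψ - (∫ ψ) η` gives `∫ f ψ = c ∫ ψ`
  set c := ∫ x in Ioo 0 ℓ, f x * η x with hc
  refine ⟨c, ?_⟩
  have hloc : LocallyIntegrableOn (fun x => f x - c) (Ioo 0 ℓ) :=
    ((integrableOn_L2 f).sub (integrable_const c)).locallyIntegrableOn
  have key := isOpen_Ioo.ae_eq_zero_of_integral_contDiff_smul_eq_zero hloc fun ψ hψ hψc hψs => by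
    have hψint : Integrable ψ := hψ.continuous.integrable_of_hasCompactSupport hψc
    have hηint : Integrable η := hηs.continuous.integrable_of_hasCompactSupport hηc
    set m := ∫ x, ψ x with hm
    -- both supports lie in a common compact subinterval
    obtain ⟨a, ha, b, hb, hab⟩ : ∃ a, 0 < a ∧ ∃ b, b < ℓ ∧
        Function.support (fun x => ψ x - m * η x) ⊆ Icc a b := by
      have hK : IsCompact (tsupport ψ ∪ Icc (ℓ / 4) (3 * ℓ / 4)) :=
        hψc.isCompact.union isCompact_Icc
      have hKsub : tsupport ψ ∪ Icc (ℓ / 4) (3 * ℓ / 4) ⊆ Ioo 0 ℓ :=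
        union_subset hψs fun x hx => ⟨by linarith [hx.1], by linarith [hx.2]⟩
      have hne : (tsupport ψ ∪ Icc (ℓ / 4) (3 * ℓ / 4)).Nonempty :=
        ⟨ℓ / 2, Or.inr ⟨by linarith, by linarith⟩⟩
      obtain ⟨a, ha, hamin⟩ := hK.exists_isLeast hne
      obtain ⟨b, hb, hbmax⟩ := hK.exists_isGreatest hne
      refine ⟨a, (hKsub ha).1, b, (hKsub hb).2, fun x hx => ?_⟩
      have hxK : x ∈ tsupport ψ ∪ Icc (ℓ / 4) (3 * ℓ / 4) := by
        by_contra hxK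
        rw [mem_union, not_or] at hxK
        apply hx
        have h1 : ψ x = 0 := image_eq_zero_of_notMem_tsupport hxK.1
        have h2 : η x = 0 := image_eq_zero_of_notMem_tsupport fun h => hxK.2 (hηsupp h)
        simp [h1, h2]
      exact ⟨hamin hxK, hbmax hxK⟩
    obtain ⟨φ, h1, h2, h3, h4⟩ := exists_test_primitive (hψ.sub (contDiff_const.mul hηs)) ha hb hab
      (by rw [integral_sub hψint (hηint.const_mul m), integral_const_mul, hη1]; simp [hm])
    have h5 := hf φ h1 h2 h3
    rw [h4] at h5
    have hz : ∫ x in Ioo 0 ℓ, (0 : L2 ℓ) x * φ x = 0 := by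
      refine integral_eq_zero_of_ae ?_
      filter_upwards [Lp.coeFn_zero ℝ 2 (volume.restrict (Ioo 0 ℓ))] with x hx
      rw [hx]; simp
    rw [hz, neg_zero] at h5
    have i1 : ∀ ξ : ℝ → ℝ, Continuous ξ → HasCompactSupport ξ →
        IntegrableOn (fun x => f x * ξ x) (Ioo 0 ℓ) := by
      intro ξ hξ hξc
      obtain ⟨C, hC⟩ := hξc.exists_bound_of_continuous hξ
      exact (integrableOn_L2 f).mul_bdd (c := C) hξ.aestronglyMeasurable (Eventually.of_forall hC)
    have h6 : ∫ x in Ioo 0 ℓ, f x * ψ x = m * c := by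
      have e : ∀ x, f x * (ψ x - m * η x) = f x * ψ x - m * (f x * η x) := fun x => by ring
      simp only [e] at h5
      rw [integral_sub (i1 ψ hψ.continuous hψc) ((i1 η hηs.continuous hηc).const_mul m),
        integral_const_mul] at h5
      linarith
    have h7 : ∫ x in Ioo 0 ℓ, ψ x = m :=
      setIntegral_eq_integral_of_forall_compl_eq_zero fun x hx =>
        image_eq_zero_of_notMem_tsupport fun h => hx (hψs h)
    rw [← setIntegral_eq_integral_of_forall_compl_eq_zero (s := Ioo 0 ℓ) fun x hx => by
      rw [image_eq_zero_of_notMem_tsupport fun h => hx (hψs h), zero_smul]]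
    have e : ∀ x, ψ x • (f x - c) = f x * ψ x - c * ψ x := fun x => by
      rw [smul_eq_mul]; ring
    simp only [e]
    rw [integral_sub (i1 ψ hψ.continuous hψc) (hψint.integrableOn.const_mul c),
      integral_const_mul, h6, h7]
    ring
  refine Lp.ext ?_
  filter_upwards [(ae_restrict_iff' measurableSet_Ioo).2 key, Lp.coeFn_smul c (oneL2 ℓ),
    coeFn_ofContinuous ℓ (continuous_const (y := (1 : ℝ)))] with x e1 e2 e3
  rw [e2, Pi.smul_apply, oneL2, e3, smul_eq_mul, mul_one]
  linarith

theorem IsWeakDeriv.exists_eq_add_primitive (hℓ : 0 < ℓ) {f g : L2 ℓ} (h : IsWeakDeriv ℓ f g) :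
    ∃ c : ℝ, f = c • oneL2 ℓ + primitive ℓ g := by
  have h1 : IsWeakDeriv ℓ (f + (-1 : ℝ) • primitive ℓ g) (g + (-1 : ℝ) • g) :=
    h.add ((isWeakDeriv_primitive hℓ.le g).smul _)
  rw [neg_one_smul, neg_one_smul, add_neg_cancel] at h1
  obtain ⟨c, hc⟩ := h1.eq_const hℓ
  exact ⟨c, by rw [← hc]; abel⟩

theorem IsWeakDeriv.eq_add_primitive (hℓ : 0 < ℓ) {f g : L2 ℓ} {c : ℝ} (h : IsWeakDeriv ℓ f g)
    (ht : HasTrace ℓ f 0 c) : f = c • oneL2 ℓ + primitive ℓ g := by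
  obtain ⟨d, hd⟩ := h.exists_eq_add_primitive hℓ
  have h1 : HasTrace ℓ f 0 (d * 1 + 0) := by
    rw [hd]; exact ((hasTrace_one 0).smul d).add (hasTrace_primitive_left g)
  have h2 := ht.unique hℓ ⟨le_rfl, hℓ.le⟩ h1
  rw [mul_one, add_zero] at h2
  rw [h2]; exact hd

end WeakDeriv

/-! ### The multiplication operator -/

section Position

/-- Multiplication by the coordinate `x` on `L²(0, ℓ)`. -/
def position (ℓ : ℝ) : L2 ℓ →L[ℝ] L2 ℓ :=
  (ContinuousLinearMap.mul ℝ ℝ).holderL (volume.restrict (Ioo 0 ℓ)) ⊤ 2 2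
    ((memLp_top_of_bound (f := fun x : ℝ => x) continuous_id.aestronglyMeasurable ℓ (by
      filter_upwards [ae_restrict_mem measurableSet_Ioo] with x hx
      rw [Real.norm_eq_abs, abs_of_pos hx.1]; exact hx.2.le)).toLp _)

theorem coeFn_position {ℓ : ℝ} (f : L2 ℓ) :
    position ℓ f =ᵐ[volume.restrict (Ioo 0 ℓ)] fun x => x * f x := by
  refine (ContinuousLinearMap.coeFn_holder _ _ _).trans ?_
  filter_upwards [MemLp.coeFn_toLp (memLp_top_of_bound (f := fun x : ℝ => x)
    (μ := volume.restrict (Ioo 0 ℓ)) continuous_id.aestronglyMeasurable ℓ (by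
      filter_upwards [ae_restrict_mem measurableSet_Ioo] with x hx
      rw [Real.norm_eq_abs, abs_of_pos hx.1]; exact hx.2.le))] with x hx
  rw [hx]; rfl

theorem position_ofContinuous {ℓ : ℝ} {g : ℝ → ℝ} (hg : Continuous g) :
    position ℓ (ofContinuous ℓ g hg) =
      ofContinuous ℓ (fun x => x * g x) (continuous_id.mul hg) := by
  refine eq_ofContinuous _ ?_
  filter_upwards [coeFn_position (ofContinuous ℓ g hg), coeFn_ofContinuous ℓ hg] with x e1 e2
  rw [e1, e2]

theorem inner_position_comm {ℓ : ℝ} (f g : L2 ℓ) :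
    inner ℝ (position ℓ f) g = inner ℝ (position ℓ g) f := by
  rw [L2.inner_def, L2.inner_def]
  refine integral_congr_ae ?_
  filter_upwards [coeFn_position f, coeFn_position g] with x e1 e2
  rw [e1, e2]
  simp only [RCLike.inner_apply, conj_trivial]
  ring

theorem inner_position_self {ℓ : ℝ} (hℓ : 0 ≤ ℓ) (f : L2 ℓ) :
    0 ≤ inner ℝ (position ℓ f) f ∧ inner ℝ (position ℓ f) f ≤ ℓ * ‖f‖ ^ 2 := by
  refine L2.induction_continuous (p := fun f => 0 ≤ inner ℝ (position ℓ f) f ∧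
    inner ℝ (position ℓ f) f ≤ ℓ * ‖f‖ ^ 2) ?_ ?_ f
  · have hc : Continuous fun f : L2 ℓ => inner ℝ (position ℓ f) f := by fun_prop
    have hn : Continuous fun f : L2 ℓ => ℓ * ‖f‖ ^ 2 := by fun_prop
    exact (isClosed_le continuous_const hc).inter (isClosed_le hc hn)
  · intro g hg
    rw [← real_inner_self_eq_norm_sq, position_ofContinuous, inner_ofContinuous hℓ,
      inner_ofContinuous hℓ, ← intervalIntegral.integral_const_mul]
    constructor
    · refine intervalIntegral.integral_nonneg hℓ fun x hx => ?_
      nlinarith [hx.1, mul_nonneg hx.1 (mul_self_nonneg (g x))]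
    · refine intervalIntegral.integral_mono_on hℓ
        (Continuous.intervalIntegrable (by fun_prop) _ _)
        (Continuous.intervalIntegrable (by fun_prop) _ _) fun x hx => ?_
      nlinarith [mul_nonneg (sub_nonneg.2 hx.2) (mul_self_nonneg (g x))]

end Position

/-! ### The third-order boundary value problem -/

section ThirdOrder

variable (ℓ : ℝ)

/-- The value `y''(0)` for the solution of `y''' = f`, `y(0) = y(ℓ) = 0`, `y'(0) = d`, as a
function of `(f, d)`. -/
def curvature : L2 ℓ × ℝ →L[ℝ] ℝ :=
  (-(2 / ℓ ^ 2)) • (ℓ • ContinuousLinearMap.snd ℝ (L2 ℓ) ℝ +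
    total ℓ ∘L primitive ℓ ∘L primitive ℓ ∘L ContinuousLinearMap.fst ℝ (L2 ℓ) ℝ)

/-- The second derivative of the solution of `y''' = f`, `y(0) = y(ℓ) = 0`, `y'(0) = d`. -/
def sol₂ : L2 ℓ × ℝ →L[ℝ] L2 ℓ :=
  (curvature ℓ).smulRight (oneL2 ℓ) + primitive ℓ ∘L ContinuousLinearMap.fst ℝ (L2 ℓ) ℝ

/-- The derivative of the solution of `y''' = f`, `y(0) = y(ℓ) = 0`, `y'(0) = d`. -/
def sol₁ : L2 ℓ × ℝ →L[ℝ] L2 ℓ :=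
  (ContinuousLinearMap.snd ℝ (L2 ℓ) ℝ).smulRight (oneL2 ℓ) + primitive ℓ ∘L sol₂ ℓ

/-- The solution of `y''' = f`, `y(0) = y(ℓ) = 0`, `y'(0) = d`. -/
def sol : L2 ℓ × ℝ →L[ℝ] L2 ℓ := primitive ℓ ∘L sol₁ ℓ

/-- The slope `y'(ℓ)` of the solution of `y''' = f`, `y(0) = y(ℓ) = 0`, `y'(0) = d`. -/
def endSlope : L2 ℓ × ℝ →L[ℝ] ℝ := ContinuousLinearMap.snd ℝ (L2 ℓ) ℝ + total ℓ ∘L sol₂ ℓ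

variable {ℓ}

theorem sol₂_apply (p : L2 ℓ × ℝ) : sol₂ ℓ p = curvature ℓ p • oneL2 ℓ + primitive ℓ p.1 := rfl

theorem sol₁_apply (p : L2 ℓ × ℝ) : sol₁ ℓ p = p.2 • oneL2 ℓ + primitive ℓ (sol₂ ℓ p) := rfl

theorem sol_apply (p : L2 ℓ × ℝ) : sol ℓ p = primitive ℓ (sol₁ ℓ p) := rfl

theorem endSlope_apply (p : L2 ℓ × ℝ) : endSlope ℓ p = p.2 + total ℓ (sol₂ ℓ p) := rfl

theorem curvature_apply (p : L2 ℓ × ℝ) : curvature ℓ p =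
    -(2 / ℓ ^ 2) * (ℓ * p.2 + total ℓ (primitive ℓ (primitive ℓ p.1))) := rfl

theorem total_one (hℓ : 0 ≤ ℓ) : total ℓ (oneL2 ℓ) = ℓ := by
  rw [oneL2, total_ofContinuous hℓ]; simp

theorem total_primitive_one (hℓ : 0 ≤ ℓ) : total ℓ (primitive ℓ (oneL2 ℓ)) = ℓ ^ 2 / 2 := by
  rw [oneL2, primitive_ofContinuous, total_ofContinuous hℓ]; simp

theorem endSlope_eq (hℓ : 0 < ℓ) (f : L2 ℓ) (d : ℝ) : endSlope ℓ (f, d) =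
    -d + total ℓ (primitive ℓ f) - 2 / ℓ * total ℓ (primitive ℓ (primitive ℓ f)) := by
  rw [endSlope_apply, sol₂_apply, curvature_apply, map_add, map_smul, total_one hℓ.le, smul_eq_mul]
  field_simp
  ring

theorem total_sol₁ (hℓ : 0 < ℓ) (p : L2 ℓ × ℝ) : total ℓ (sol₁ ℓ p) = 0 := by
  rw [sol₁_apply, sol₂_apply, curvature_apply]
  simp only [map_add, map_smul, total_one hℓ.le, total_primitive_one hℓ.le, smul_eq_mul]
  field_simp
  ring

theorem isWeakDeriv_add_primitive (hℓ : 0 ≤ ℓ) (c : ℝ) (f : L2 ℓ) :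
    IsWeakDeriv ℓ (c • oneL2 ℓ + primitive ℓ f) f := by
  simpa using ((isWeakDeriv_one hℓ).smul c).add (isWeakDeriv_primitive hℓ f)

theorem hasTrace_add_primitive_left (c : ℝ) (f : L2 ℓ) :
    HasTrace ℓ (c • oneL2 ℓ + primitive ℓ f) 0 c := by
  simpa using ((hasTrace_one 0).smul c).add (hasTrace_primitive_left f)

theorem hasTrace_add_primitive_right (hℓ : 0 ≤ ℓ) (c : ℝ) (f : L2 ℓ) :
    HasTrace ℓ (c • oneL2 ℓ + primitive ℓ f) ℓ (c + total ℓ f) := by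
  simpa using ((hasTrace_one ℓ).smul c).add (hasTrace_primitive_right hℓ f)

theorem hasTrace_sol_right (hℓ : 0 < ℓ) (p : L2 ℓ × ℝ) : HasTrace ℓ (sol ℓ p) ℓ 0 := by
  have h := hasTrace_primitive_right hℓ.le (sol₁ ℓ p)
  rwa [total_sol₁ hℓ] at h

theorem isWeakDeriv_sol (hℓ : 0 ≤ ℓ) (p : L2 ℓ × ℝ) : IsWeakDeriv ℓ (sol ℓ p) (sol₁ ℓ p) :=
  isWeakDeriv_primitive hℓ _

/-- Uniqueness for the third-order boundary value problem. -/
theorem eq_sol (hℓ : 0 < ℓ) {y y₁ y₂ y₃ : L2 ℓ} {d : ℝ} (h1 : IsWeakDeriv ℓ y y₁)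
    (h2 : IsWeakDeriv ℓ y₁ y₂) (h3 : IsWeakDeriv ℓ y₂ y₃) (t0 : HasTrace ℓ y 0 0)
    (tL : HasTrace ℓ y ℓ 0) (td : HasTrace ℓ y₁ 0 d) :
    y = sol ℓ (y₃, d) ∧ y₁ = sol₁ ℓ (y₃, d) := by
  obtain ⟨c, hc⟩ := h3.exists_eq_add_primitive hℓ
  have e1 := h2.eq_add_primitive hℓ td
  have e0 := h1.eq_add_primitive hℓ t0
  rw [zero_smul, zero_add] at e0
  have hz : total ℓ y₁ = 0 :=
    ((hasTrace_primitive_right hℓ.le y₁).unique hℓ ⟨hℓ.le, le_rfl⟩ (e0 ▸ tL))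
  have hcc : c = curvature ℓ (y₃, d) := by
    rw [e1, hc] at hz
    simp only [map_add, map_smul, total_one hℓ.le, total_primitive_one hℓ.le, smul_eq_mul] at hz
    rw [curvature_apply]
    field_simp
    linarith
  have e2 : y₂ = sol₂ ℓ (y₃, d) := by rw [hc, hcc]; rfl
  have e1' : y₁ = sol₁ ℓ (y₃, d) := by rw [e1, e2]; rfl
  exact ⟨by rw [e0, e1']; rfl, e1'⟩

/-- For continuous right-hand side the solution is a classical one. -/
theorem exists_classical_sol (hℓ : 0 < ℓ) {f : ℝ → ℝ} (hf : Continuous f) (d : ℝ) :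
    ∃ (y y₁ y₂ : ℝ → ℝ) (hy : Continuous y) (hy₁ : Continuous y₁),
      (∀ x, HasDerivAt y (y₁ x) x) ∧ (∀ x, HasDerivAt y₁ (y₂ x) x) ∧
      (∀ x, HasDerivAt y₂ (f x) x) ∧ y 0 = 0 ∧ y ℓ = 0 ∧ y₁ 0 = d ∧
      y₁ ℓ = endSlope ℓ (ofContinuous ℓ f hf, d) ∧
      sol ℓ (ofContinuous ℓ f hf, d) = ofContinuous ℓ y hy ∧
      sol₁ ℓ (ofContinuous ℓ f hf, d) = ofContinuous ℓ y₁ hy₁ := by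
  set p : L2 ℓ × ℝ := (ofContinuous ℓ f hf, d) with hp
  set γ := curvature ℓ p
  have h2 : Continuous fun x => γ * 1 + ∫ s in (0 : ℝ)..x, f s :=
    continuous_const.add (continuous_integral hf)
  have e2 : sol₂ ℓ p = ofContinuous ℓ _ h2 := by
    rw [sol₂_apply, hp, primitive_ofContinuous, oneL2, smul_ofContinuous, ofContinuous_add]
  have h1 : Continuous fun x => d * 1 + ∫ s in (0 : ℝ)..x, (γ * 1 + ∫ r in (0 : ℝ)..s, f r) :=
    continuous_const.add (continuous_integral h2)
  have e1 : sol₁ ℓ p = ofContinuous ℓ _ h1 := by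
    rw [sol₁_apply, e2, primitive_ofContinuous, oneL2, smul_ofContinuous, ofContinuous_add]
  have e0 : sol ℓ p = ofContinuous ℓ _ (continuous_integral h1) := by
    rw [sol_apply, e1, primitive_ofContinuous]
  refine ⟨_, _, _, continuous_integral h1, h1, hasDerivAt_integral h1,
    fun x => (hasDerivAt_integral h2 x).const_add _,
    fun x => (hasDerivAt_integral hf x).const_add _, by simp, ?_, by simp, ?_, e0, e1⟩
  · rw [← total_ofContinuous hℓ.le h1, ← e1, total_sol₁ hℓ]
  · rw [endSlope_apply, e2, total_ofContinuous hℓ.le h2, mul_one]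

/-- The energy identity for the third derivative. -/
theorem inner_sol (hℓ : 0 < ℓ) (f : L2 ℓ) (d : ℝ) :
    inner ℝ f (sol ℓ (f, d)) = -(1 / 2) * (endSlope ℓ (f, d) ^ 2 - d ^ 2) := by
  refine L2.induction_continuous (p := fun f => inner ℝ f (sol ℓ (f, d)) =
    -(1 / 2) * (endSlope ℓ (f, d) ^ 2 - d ^ 2)) ?_ ?_ f
  · exact isClosed_eq (by fun_prop) (by fun_prop)
  · intro f hf
    obtain ⟨y, y₁, y₂, hy, hy₁, d0, d1, d2, h0, hL, hs, he, e0, e1⟩ :=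
      exists_classical_sol hℓ hf d
    -- `(y y'' - y'² / 2)' = y y'''`
    have h := intervalIntegral.integral_eq_sub_of_hasDerivAt (a := 0) (b := ℓ)
      (f := fun x => y x * y₂ x - 1 / 2 * y₁ x ^ 2) (f' := fun x => f x * y x)
      (fun x _ => by
        have := ((d0 x).mul (d2 x)).sub (((d1 x).pow 2).const_mul (1 / 2))
        exact this.congr_deriv (by simp; ring))
      ((hf.mul hy).intervalIntegrable _ _)
    rw [e0, inner_ofContinuous hℓ.le, ← he, h, h0, hL, hs]
    ring

/-- The energy identity with the multiplier `x`. -/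
theorem inner_position_sol (hℓ : 0 < ℓ) (f : L2 ℓ) (d : ℝ) :
    inner ℝ (position ℓ f) (sol ℓ (f, d)) =
      3 / 2 * ‖sol₁ ℓ (f, d)‖ ^ 2 - ℓ / 2 * endSlope ℓ (f, d) ^ 2 := by
  refine L2.induction_continuous (p := fun f => inner ℝ (position ℓ f) (sol ℓ (f, d)) =
      3 / 2 * ‖sol₁ ℓ (f, d)‖ ^ 2 - ℓ / 2 * endSlope ℓ (f, d) ^ 2) ?_ ?_ f
  · exact isClosed_eq (by fun_prop) (by fun_prop)
  · intro f hf
    obtain ⟨y, y₁, y₂, hy, hy₁, d0, d1, d2, h0, hL, hs, he, e0, e1⟩ :=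
      exists_classical_sol hℓ hf d
    -- `(x y y'' - x y'² / 2 - y y')' = x y y''' - 3/2 y'²`
    have h := intervalIntegral.integral_eq_sub_of_hasDerivAt (a := 0) (b := ℓ)
      (f := fun x => x * (y x * y₂ x) - 1 / 2 * (x * y₁ x ^ 2) - y x * y₁ x)
      (f' := fun x => x * f x * y x - 3 / 2 * (y₁ x * y₁ x))
      (fun x _ => by
        have := (((hasDerivAt_id x).mul ((d0 x).mul (d2 x))).sub
          (((hasDerivAt_id x).mul ((d1 x).pow 2)).const_mul (1 / 2))).sub ((d0 x).mul (d1 x))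
        exact this.congr_deriv (by simp; ring))
      (Continuous.intervalIntegrable (by fun_prop) _ _)
    rw [intervalIntegral.integral_sub (Continuous.intervalIntegrable (by fun_prop) _ _)
      (Continuous.intervalIntegrable (by fun_prop) _ _), intervalIntegral.integral_const_mul,
      h0, hL] at h
    rw [e0, e1, ← real_inner_self_eq_norm_sq, position_ofContinuous, inner_ofContinuous hℓ.le,
      inner_ofContinuous hℓ.le, ← he]
    linarith

/-- The energy identity for the first derivative. -/
theorem inner_add_primitive (hℓ : 0 ≤ ℓ) (f : L2 ℓ) (a : ℝ) :
    inner ℝ f (a • oneL2 ℓ + primitive ℓ f) = 1 / 2 * ((a + total ℓ f) ^ 2 - a ^ 2) := by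
  refine L2.induction_continuous (p := fun f => inner ℝ f (a • oneL2 ℓ + primitive ℓ f) =
    1 / 2 * ((a + total ℓ f) ^ 2 - a ^ 2)) ?_ ?_ f
  · exact isClosed_eq (by fun_prop) (by fun_prop)
  · intro f hf
    have hd := fun x => (hasDerivAt_integral hf x).const_add (a * 1)
    have hc : Continuous fun x => a * 1 + ∫ s in (0 : ℝ)..x, f s :=
      continuous_const.add (continuous_integral hf)
    have h := intervalIntegral.integral_eq_sub_of_hasDerivAt (a := 0) (b := ℓ)
      (f := fun x => 1 / 2 * (a * 1 + ∫ s in (0 : ℝ)..x, f s) ^ 2)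
      (f' := fun x => f x * (a * 1 + ∫ s in (0 : ℝ)..x, f s))
      (fun x _ => by
        have := ((hd x).pow 2).const_mul (1 / 2)
        exact this.congr_deriv (by simp; ring))
      ((hf.mul hc).intervalIntegrable _ _)
    rw [primitive_ofContinuous, oneL2, smul_ofContinuous, ofContinuous_add,
      inner_ofContinuous hℓ, h, total_ofContinuous hℓ, intervalIntegral.integral_same]
    ring

theorem IsWeakDeriv.eq_zero {g : L2 ℓ} (h : IsWeakDeriv ℓ 0 g) : g = 0 := by
  rw [isWeakDeriv_iff_inner] at h
  simp only [inner_zero_right, zero_eq_neg, inner_ofContinuous_left] at h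
  have key := isOpen_Ioo.ae_eq_zero_of_integral_contDiff_smul_eq_zero
    (integrableOn_L2 g).locallyIntegrableOn fun ψ hψ hψc hψs => by
      rw [← setIntegral_eq_integral_of_forall_compl_eq_zero (s := Ioo 0 ℓ) fun x hx => by
        rw [image_eq_zero_of_notMem_tsupport fun h => hx (hψs h), zero_smul]]
      simpa only [smul_eq_mul, mul_comm] using h ψ hψ hψc hψs
  refine Lp.ext ?_
  filter_upwards [(ae_restrict_iff' measurableSet_Ioo).2 key,
    Lp.coeFn_zero ℝ 2 (volume.restrict (Ioo 0 ℓ))] with x e1 e2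
  rw [e1, e2]; rfl

end ThirdOrder

/-! ### The inverse of the generator -/

section Generator

variable (L α β h : ℝ)

/-- The data of the boundary value problem that determines `u` from `w = A (u, v, z)`. -/
def dataU : StateSpace L →L[ℝ] L2 L × ℝ :=
  ((2 : ℝ) • ContinuousLinearMap.fst ℝ (L2 L) (L2 L × L2 1)).prod 0

/-- The right-hand side of the equation that determines `z` from `w = A (u, v, z)`. -/
def rhsZ : StateSpace L →L[ℝ] L2 1 :=
  (-h) • (ContinuousLinearMap.snd ℝ (L2 L) (L2 1) ∘L
    ContinuousLinearMap.snd ℝ (L2 L) (L2 L × L2 1))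

/-- The slope `u_x(L)` as a function of `w = A (u, v, z)`. -/
def slopeU : StateSpace L →L[ℝ] ℝ := endSlope L ∘L dataU L

/-- The delayed slope `z(1)` as a function of `w = A (u, v, z)`. -/
def delayed : StateSpace L →L[ℝ] ℝ := slopeU L + total 1 ∘L rhsZ L h

/-- The third derivative of `v` as a function of `w = A (u, v, z)`. -/
def rhsV : StateSpace L →L[ℝ] L2 L :=
  -(ContinuousLinearMap.fst ℝ (L2 L) (L2 1) ∘L ContinuousLinearMap.snd ℝ (L2 L) (L2 L × L2 1))

/-- The slope `v_x(0)` as a function of `w = A (u, v, z)`; it is the slope for which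
`v_x(L) = α u_x(L) + β z(1)`. -/
def slopeV : StateSpace L →L[ℝ] ℝ :=
  (total L ∘L primitive L - (2 / L) • (total L ∘L primitive L ∘L primitive L)) ∘L rhsV L -
    (α • slopeU L + β • delayed L h)

/-- The data of the boundary value problem that determines `v` from `w = A (u, v, z)`. -/
def dataV : StateSpace L →L[ℝ] L2 L × ℝ := (rhsV L).prod (slopeV L α β h)

/-- The inverse of the operator `A`. -/
def inverseA : StateSpace L →L[ℝ] StateSpace L :=
  (sol L ∘L dataU L).prod ((sol L ∘L dataV L α β h).prod
    ((slopeU L).smulRight (oneL2 1) + primitive 1 ∘L rhsZ L h))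

/-- The quantities `(u_x(L), z(1), u_x, v_x)` as functions of `w = A (u, v, z)`. -/
def observation : StateSpace L →L[ℝ] ℝ × ℝ × L2 L × L2 L :=
  (slopeU L).prod ((delayed L h).prod ((sol₁ L ∘L dataU L).prod (sol₁ L ∘L dataV L α β h)))

variable {L α β h}

theorem dataU_apply (W : StateSpace L) : dataU L W = ((2 : ℝ) • W.1, 0) := rfl

theorem rhsZ_apply (W : StateSpace L) : rhsZ L h W = (-h) • W.2.2 := rfl

theorem rhsV_apply (W : StateSpace L) : rhsV L W = - W.2.1 := rfl

theorem delayed_apply (W : StateSpace L) :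
    delayed L h W = slopeU L W + total 1 (rhsZ L h W) := rfl

theorem dataV_apply (W : StateSpace L) : dataV L α β h W = (rhsV L W, slopeV L α β h W) := rfl

theorem slopeV_apply (W : StateSpace L) : slopeV L α β h W =
    total L (primitive L (rhsV L W)) - 2 / L * total L (primitive L (primitive L (rhsV L W))) -
      (α * slopeU L W + β * delayed L h W) := rfl

theorem inverseA_fst (W : StateSpace L) : (inverseA L α β h W).1 = sol L (dataU L W) := rfl

theorem inverseA_snd_fst (W : StateSpace L) :
    (inverseA L α β h W).2.1 = sol L (dataV L α β h W) := rfl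

theorem inverseA_snd_snd (W : StateSpace L) :
    (inverseA L α β h W).2.2 = slopeU L W • oneL2 1 + primitive 1 (rhsZ L h W) := rfl

theorem observation_apply (W : StateSpace L) : observation L α β h W =
    (slopeU L W, delayed L h W, sol₁ L (dataU L W), sol₁ L (dataV L α β h W)) := rfl

/-- The slope chosen at `0` realizes the feedback law at `L`. -/
theorem endSlope_dataV (hL : 0 < L) (W : StateSpace L) :
    endSlope L (dataV L α β h W) = α * slopeU L W + β * delayed L h W := by
  rw [dataV_apply, endSlope_eq hL, slopeV_apply]; ring

theorem hasTrace_sol₁_left (p : L2 L × ℝ) : HasTrace L (sol₁ L p) 0 p.2 :=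
  hasTrace_add_primitive_left _ _

theorem hasTrace_sol₁_right (hL : 0 ≤ L) (p : L2 L × ℝ) :
    HasTrace L (sol₁ L p) L (endSlope L p) :=
  hasTrace_add_primitive_right hL _ _

theorem graphA_inverseA (hL : 0 < L) (hh : 0 < h) (W : StateSpace L) :
    GraphA L α β h (inverseA L α β h W) W := by
  have htrz := hasTrace_add_primitive_right (ℓ := 1) zero_le_one (slopeU L W) (rhsZ L h W)
  refine ⟨sol₁ L (dataU L W), sol₂ L (dataU L W), (dataU L W).1, sol₁ L (dataV L α β h W),
    sol₂ L (dataV L α β h W), rhsV L W, rhsZ L h W, slopeU L W, delayed L h W,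
    isWeakDeriv_sol hL.le _, isWeakDeriv_add_primitive hL.le _ _,
    isWeakDeriv_add_primitive hL.le _ _, isWeakDeriv_sol hL.le _,
    isWeakDeriv_add_primitive hL.le _ _, isWeakDeriv_add_primitive hL.le _ _,
    isWeakDeriv_add_primitive zero_le_one _ _, hasTrace_primitive_left _, hasTrace_sol_right hL _,
    hasTrace_primitive_left _, hasTrace_sol_right hL _, hasTrace_sol₁_left _,
    hasTrace_sol₁_right hL.le _, hasTrace_add_primitive_left _ _, htrz, ?_, ?_⟩
  · rw [← endSlope_dataV hL]; exact hasTrace_sol₁_right hL.le _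
  · rw [dataU_apply, rhsV_apply, rhsZ_apply, smul_smul, smul_smul, neg_neg]
    have : -(h⁻¹ * -h) = 1 := by field_simp
    rw [← neg_smul, this]
    norm_num

theorem GraphA.eq_inverseA (hL : 0 < L) (hh : 0 < h) {U W : StateSpace L}
    (hg : GraphA L α β h U W) : U = inverseA L α β h W := by
  obtain ⟨u₁, u₂, u₃, v₁, v₂, v₃, z₁, a, b, hu1, hu2, hu3, hv1, hv2, hv3, hz1, tu0, tuL, tv0, tvL,
    tu', ta, tza, tzb, tv', rfl⟩ := hg
  set W : StateSpace L := ((1 / 2 : ℝ) • u₃, - v₃, - (h⁻¹ • z₁)) with hW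
  have edU : dataU L W = (u₃, 0) := by
    rw [dataU_apply, hW]
    simp only [smul_smul]
    norm_num
  have erV : rhsV L W = v₃ := by rw [rhsV_apply, hW]; simp
  have erZ : rhsZ L h W = z₁ := by
    rw [rhsZ_apply, hW]
    simp only [smul_neg, smul_smul]
    rw [neg_mul, mul_inv_cancel₀ hh.ne', neg_one_smul, neg_neg]
  obtain ⟨eu, eu1⟩ := eq_sol hL hu1 hu2 hu3 tu0 tuL tu'
  have hLL : L ∈ Icc 0 L := ⟨hL.le, le_rfl⟩
  have ea : slopeU L W = a := by
    refine HasTrace.unique hL hLL ?_ ta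
    rw [eu1, ← edU]; exact hasTrace_sol₁_right hL.le _
  have ez := hz1.eq_add_primitive one_pos tza
  have eb : delayed L h W = b := by
    refine HasTrace.unique one_pos (a := 1) ⟨zero_le_one, le_rfl⟩ ?_ tzb
    rw [delayed_apply, ea, erZ, ez]
    exact hasTrace_add_primitive_right zero_le_one _ _
  obtain ⟨d, hd⟩ := hv2.exists_eq_add_primitive hL
  have td : HasTrace L v₁ 0 d := by rw [hd]; exact hasTrace_add_primitive_left _ _
  obtain ⟨ev, ev1⟩ := eq_sol hL hv1 hv2 hv3 tv0 tvL td
  have es : endSlope L (v₃, d) = α * a + β * b := by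
    refine HasTrace.unique hL hLL ?_ tv'
    rw [ev1]; exact hasTrace_sol₁_right hL.le _
  have esl : slopeV L α β h W = d := by
    rw [endSlope_eq hL] at es
    rw [slopeV_apply, ea, eb, erV, ← es]; ring
  refine Prod.ext ?_ (Prod.ext ?_ ?_)
  · rw [inverseA_fst, edU, eu]
  · rw [inverseA_snd_fst, dataV_apply, erV, esl, ev]
  · rw [inverseA_snd_snd, ea, erZ, ez]

theorem inverseA_injective (hL : 0 < L) (hh : 0 < h) :
    Function.Injective (inverseA L α β h) := by
  rw [injective_iff_map_eq_zero]
  intro W hW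
  have hg := graphA_inverseA (α := α) (β := β) hL hh W
  rw [hW] at hg
  obtain ⟨u₁, u₂, u₃, v₁, v₂, v₃, z₁, a, b, hu1, hu2, hu3, hv1, hv2, hv3, hz1, -, -, -, -, -, -, -,
    -, -, rfl⟩ := hg
  obtain rfl := IsWeakDeriv.eq_zero hu1
  obtain rfl := IsWeakDeriv.eq_zero hu2
  obtain rfl := IsWeakDeriv.eq_zero hu3
  obtain rfl := IsWeakDeriv.eq_zero hv1
  obtain rfl := IsWeakDeriv.eq_zero hv2
  obtain rfl := IsWeakDeriv.eq_zero hv3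
  obtain rfl := IsWeakDeriv.eq_zero hz1
  simp

end Generator

/-! ### The energy form -/

section Form

variable (L β h K : ℝ)

/-- The weighted inner product
`∫ (K + L - x) u u' + ∫ (K + x) v v' + K β h ∫ z z'` on the state space. -/
def energyForm : StateSpace L →L[ℝ] StateSpace L →L[ℝ] ℝ :=
  let p₁ := ContinuousLinearMap.fst ℝ (L2 L) (L2 L × L2 1)
  let p₂ := ContinuousLinearMap.fst ℝ (L2 L) (L2 1) ∘L
    ContinuousLinearMap.snd ℝ (L2 L) (L2 L × L2 1)
  let p₃ := ContinuousLinearMap.snd ℝ (L2 L) (L2 1) ∘L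
    ContinuousLinearMap.snd ℝ (L2 L) (L2 L × L2 1)
  (K + L) • (innerSL ℝ (E := L2 L)).bilinearComp p₁ p₁ -
    (innerSL ℝ (E := L2 L)).bilinearComp (position L ∘L p₁) p₁ +
    (K • (innerSL ℝ (E := L2 L)).bilinearComp p₂ p₂ +
    (innerSL ℝ (E := L2 L)).bilinearComp (position L ∘L p₂) p₂) +
    (K * β * h) • (innerSL ℝ (E := L2 1)).bilinearComp p₃ p₃

variable {L β h K}

theorem energyForm_apply (U V : StateSpace L) : energyForm L β h K U V =
    (K + L) * inner ℝ U.1 V.1 - inner ℝ (position L U.1) V.1 +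
      (K * inner ℝ U.2.1 V.2.1 + inner ℝ (position L U.2.1) V.2.1) +
      K * β * h * inner ℝ U.2.2 V.2.2 := rfl

theorem energyForm_comm (U V : StateSpace L) :
    energyForm L β h K U V = energyForm L β h K V U := by
  rw [energyForm_apply, energyForm_apply, inner_position_comm U.1, inner_position_comm U.2.1,
    real_inner_comm V.1 U.1, real_inner_comm V.2.1 U.2.1, real_inner_comm V.2.2 U.2.2]

theorem norm_sq_le_of_prod {E F : Type*} [NormedAddCommGroup E] [NormedAddCommGroup F]
    (p : E × F) : ‖p‖ ^ 2 ≤ ‖p.1‖ ^ 2 + ‖p.2‖ ^ 2 := by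
  rw [Prod.norm_def]
  rcases max_cases ‖p.1‖ ‖p.2‖ with ⟨e, _⟩ | ⟨e, _⟩ <;> rw [e] <;>
    nlinarith [sq_nonneg ‖p.1‖, sq_nonneg ‖p.2‖]

theorem energyForm_coercive (hL : 0 ≤ L) (hK : 0 ≤ K) (hβh : 0 ≤ β * h)
    (U : StateSpace L) : min K (K * β * h) * ‖U‖ ^ 2 ≤ energyForm L β h K U U := by
  rw [energyForm_apply]
  simp only [real_inner_self_eq_norm_sq]
  have h1 := (inner_position_self hL U.1).2
  have h2 := (inner_position_self hL U.2.1).1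
  have h3 : ‖U‖ ^ 2 ≤ ‖U.1‖ ^ 2 + (‖U.2.1‖ ^ 2 + ‖U.2.2‖ ^ 2) :=
    (norm_sq_le_of_prod U).trans (by gcongr; exact norm_sq_le_of_prod U.2)
  have hm1 : min K (K * β * h) ≤ K := min_le_left _ _
  have hm2 : min K (K * β * h) ≤ K * β * h := min_le_right _ _
  have hm0 : 0 ≤ min K (K * β * h) := le_min hK (by rw [mul_assoc]; positivity)
  calc min K (K * β * h) * ‖U‖ ^ 2
      ≤ min K (K * β * h) * (‖U.1‖ ^ 2 + (‖U.2.1‖ ^ 2 + ‖U.2.2‖ ^ 2)) := by gcongr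
    _ ≤ K * ‖U.1‖ ^ 2 + K * ‖U.2.1‖ ^ 2 + K * β * h * ‖U.2.2‖ ^ 2 := by
        have e1 := mul_le_mul_of_nonneg_right hm1 (sq_nonneg ‖U.1‖)
        have e2 := mul_le_mul_of_nonneg_right hm1 (sq_nonneg ‖U.2.1‖)
        have e3 := mul_le_mul_of_nonneg_right hm2 (sq_nonneg ‖U.2.2‖)
        linarith
    _ ≤ _ := by linarith

/-- The energy identity for the generator. -/
theorem energyForm_inverseA (hL : 0 < L) (α : ℝ) (W : StateSpace L) :
    energyForm L β h K W (inverseA L α β h W) =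
      -(K / 4) * slopeU L W ^ 2 - 3 / 4 * ‖sol₁ L (dataU L W)‖ ^ 2 +
      (K + L) / 2 * (α * slopeU L W + β * delayed L h W) ^ 2 -
      K / 2 * slopeV L α β h W ^ 2 - 3 / 2 * ‖sol₁ L (dataV L α β h W)‖ ^ 2 -
      K * β / 2 * (delayed L h W ^ 2 - slopeU L W ^ 2) := by
  have hu1 := inner_sol hL ((2 : ℝ) • W.1) 0
  have hu2 := inner_position_sol hL ((2 : ℝ) • W.1) 0
  have hv1 := inner_sol hL (rhsV L W) (slopeV L α β h W)
  have hv2 := inner_position_sol hL (rhsV L W) (slopeV L α β h W)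
  have hz := inner_add_primitive zero_le_one (rhsZ L h W) (slopeU L W)
  rw [← dataU_apply] at hu1 hu2
  rw [← dataV_apply, endSlope_dataV hL] at hv1 hv2
  rw [← delayed_apply, rhsZ_apply, inner_smul_left] at hz
  change _ = -(1 / 2) * (slopeU L W ^ 2 - 0 ^ 2) at hu1
  change _ = _ - L / 2 * slopeU L W ^ 2 at hu2
  rw [inner_smul_left] at hu1
  rw [map_smul, inner_smul_left] at hu2
  rw [rhsV_apply, inner_neg_left] at hv1
  rw [rhsV_apply, map_neg, inner_neg_left] at hv2
  simp only [conj_trivial] at hu1 hu2 hz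
  rw [energyForm_apply, inverseA_fst, inverseA_snd_fst, inverseA_snd_snd]
  rw [← rhsZ_apply] at hz
  linear_combination (K + L) / 2 * hu1 - 1 / 2 * hu2 - K * hv1 - hv2 - K * β * hz

theorem exists_energyForm_dissipative (hL : 0 < L) (hβ : 0 < β)  {α : ℝ}
    (hcond : 2 * α ^ 2 + 3 / 2 * β < 1 / 2) :
    ∃ K : ℝ, 0 < K ∧ ∀ W : StateSpace L, energyForm L β h K W (inverseA L α β h W) ≤
      -(1 / 2 * ‖observation L α β h W‖ ^ 2) := by
  set δ := min (1 / 4 - α ^ 2 - β / 2) (β / 2 - β ^ 2) with hδ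
  have hβ3 : β < 1 / 3 := by nlinarith [sq_nonneg α]
  have hα : α ^ 2 < 1 / 4 := by linarith
  have hδ1 : δ ≤ 1 / 4 - α ^ 2 - β / 2 := min_le_left _ _
  have hδ2 : δ ≤ β / 2 - β ^ 2 := min_le_right _ _
  have hδ0 : 0 < δ := lt_min (by linarith) (by nlinarith)
  -- `K δ = L / 2 + 1` pays for the boundary term `L / 2 * s ^ 2` of the multipliers
  refine ⟨(L / 2 + 1) / δ, by positivity, fun W => ?_⟩
  set K := (L / 2 + 1) / δ with hK
  have hKδ : K * δ = L / 2 + 1 := by rw [hK]; field_simp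
  have hK0 : 0 < K := by positivity
  rw [energyForm_inverseA hL]
  have hobs : ‖observation L α β h W‖ ^ 2 ≤ slopeU L W ^ 2 + (delayed L h W ^ 2 +
      (‖sol₁ L (dataU L W)‖ ^ 2 + ‖sol₁ L (dataV L α β h W)‖ ^ 2)) := by
    rw [observation_apply]
    refine (norm_sq_le_of_prod _).trans (add_le_add (by simp) ?_)
    refine (norm_sq_le_of_prod _).trans (add_le_add (by simp) ?_)
    exact norm_sq_le_of_prod _
  set a := slopeU L W
  set b := delayed L h W
  set s := α * a + β * b with hs
  have hs2 : s ^ 2 ≤ 2 * α ^ 2 * a ^ 2 + 2 * β ^ 2 * b ^ 2 := by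
    rw [hs]; nlinarith [sq_nonneg (α * a - β * b)]
  have hs1 : s ^ 2 ≤ a ^ 2 + b ^ 2 := by
    have e1 : α ^ 2 * a ^ 2 ≤ 1 / 2 * a ^ 2 :=
      mul_le_mul_of_nonneg_right (by linarith) (sq_nonneg a)
    have e2 : β ^ 2 * b ^ 2 ≤ 1 / 2 * b ^ 2 :=
      mul_le_mul_of_nonneg_right (by nlinarith) (sq_nonneg b)
    linarith
  have hq : -(1 / 4) * a ^ 2 + 1 / 2 * s ^ 2 - β / 2 * (b ^ 2 - a ^ 2) ≤
      -(δ * (a ^ 2 + b ^ 2)) := by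
    have e1 := mul_le_mul_of_nonneg_right hδ1 (sq_nonneg a)
    have e2 := mul_le_mul_of_nonneg_right hδ2 (sq_nonneg b)
    linarith
  have hq' := mul_le_mul_of_nonneg_left hq hK0.le
  have hq'' : K * -(δ * (a ^ 2 + b ^ 2)) = -((L / 2 + 1) * (a ^ 2 + b ^ 2)) := by
    rw [← hKδ]; ring
  rw [hq''] at hq'
  have hLs : L / 2 * s ^ 2 ≤ L / 2 * (a ^ 2 + b ^ 2) := by gcongr
  have hd : 0 ≤ K / 2 * slopeV L α β h W ^ 2 := by positivity
  have ha := sq_nonneg a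
  have hb := sq_nonneg b
  have h1 := sq_nonneg ‖sol₁ L (dataU L W)‖
  have h2 := sq_nonneg ‖sol₁ L (dataV L α β h W)‖
  linarith

theorem hasLaxMilgram_stateSpace : HasLaxMilgram (StateSpace L) := by
  let e₁ : StateSpace L ≃L[ℝ] L2 L × WithLp 2 (L2 L × L2 1) :=
    (ContinuousLinearEquiv.refl ℝ (L2 L)).prodCongr
      (WithLp.prodContinuousLinearEquiv 2 ℝ (L2 L) (L2 1)).symm
  let e₂ : (L2 L × WithLp 2 (L2 L × L2 1)) ≃L[ℝ] WithLp 2 (L2 L × WithLp 2 (L2 L × L2 1)) :=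
    (WithLp.prodContinuousLinearEquiv 2 ℝ (L2 L) (WithLp 2 (L2 L × L2 1))).symm
  exact hasLaxMilgram_of_hilbert.of_equiv (e₁.trans e₂)

end Form

/-! ### Mild solutions of the system -/

section MildSolution

variable {L T α β h : ℝ}

/-- Mild solutions in terms of the bounded operator `A⁻¹`; the initial condition follows from the
equation at `t = 0`, as `A⁻¹` is injective. -/
theorem isMildSolution_iff (hL : 0 < L) (hT : 0 ≤ T) (hh : 0 < h) {U₀ : StateSpace L}
    {f₁ f₂ : ℝ → L2 L} {U : ℝ → StateSpace L} :
    IsMildSolution L T α β h U₀ f₁ f₂ U ↔ ContinuousOn U (Icc 0 T) ∧ ∀ t ∈ Icc 0 T,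
      ∫ s in (0 : ℝ)..t, U s = inverseA L α β h
        (U t - U₀ - ∫ s in (0 : ℝ)..t, ((f₁ s, f₂ s, 0) : StateSpace L)) := by
  constructor
  · intro hU
    exact ⟨hU.continuousOn, fun t ht => (hU.equation t ht).eq_inverseA hL hh⟩
  · rintro ⟨hc, heq⟩
    refine ⟨hc, ?_, fun t ht => ?_⟩
    · have h0 := heq 0 ⟨le_rfl, hT⟩
      rw [intervalIntegral.integral_same, intervalIntegral.integral_same, sub_zero] at h0
      have h1 : U 0 - U₀ = 0 := inverseA_injective hL hh (by rw [← h0, map_zero])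
      exact sub_eq_zero.1 h1
    · rw [heq t ht]
      exact graphA_inverseA hL hh _

theorem norm_le_normH (hβh : 0 < β * h) (U : StateSpace L) :
    √(min 1 (β * h)) * ‖U‖ ≤ normH β h U := by
  have hm0 : 0 ≤ min 1 (β * h) := le_min zero_le_one hβh.le
  refine Real.le_sqrt_of_sq_le ?_
  rw [mul_pow, Real.sq_sqrt hm0]
  have h3 : ‖U‖ ^ 2 ≤ ‖U.1‖ ^ 2 + (‖U.2.1‖ ^ 2 + ‖U.2.2‖ ^ 2) :=
    (norm_sq_le_of_prod U).trans (by gcongr; exact norm_sq_le_of_prod U.2)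
  have e0 := mul_le_mul_of_nonneg_left h3 hm0
  have e1 := mul_le_mul_of_nonneg_right (min_le_left 1 (β * h)) (sq_nonneg ‖U.1‖)
  have e2 := mul_le_mul_of_nonneg_right (min_le_left 1 (β * h)) (sq_nonneg ‖U.2.1‖)
  have e3 := mul_le_mul_of_nonneg_right (min_le_right 1 (β * h)) (sq_nonneg ‖U.2.2‖)
  linarith

theorem normH_le_norm (hβh : 0 < β * h) (U : StateSpace L) :
    normH β h U ≤ √(2 + β * h) * ‖U‖ := by
  refine Real.sqrt_le_iff.2 ⟨by positivity, ?_⟩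
  rw [mul_pow, Real.sq_sqrt (by positivity)]
  have h1 : ‖U.1‖ ^ 2 ≤ ‖U‖ ^ 2 := by gcongr; exact norm_fst_le U
  have h2 : ‖U.2.1‖ ^ 2 ≤ ‖U‖ ^ 2 := by
    gcongr; exact (norm_fst_le U.2).trans (norm_snd_le U)
  have h3 : ‖U.2.2‖ ^ 2 ≤ ‖U‖ ^ 2 := by
    gcongr; exact (norm_snd_le U.2).trans (norm_snd_le U)
  have h4 := mul_le_mul_of_nonneg_left h3 hβh.le
  linarith

theorem norm_source_le_normX0 (f g : L2 L) : ‖((f, g, 0) : StateSpace L)‖ ≤ normX0 f g := by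
  refine Real.le_sqrt_of_sq_le ((norm_sq_le_of_prod _).trans ?_)
  have := norm_sq_le_of_prod ((g, 0) : L2 L × L2 1)
  simp only [norm_zero, ne_eq, OfNat.ofNat_ne_zero, not_false_eq_true, zero_pow, add_zero] at this
  gcongr

theorem integrableOn_normX0 {s : Set ℝ} {f₁ f₂ : ℝ → L2 L} (h₁ : IntegrableOn f₁ s)
    (h₂ : IntegrableOn f₂ s) : IntegrableOn (fun t => normX0 (f₁ t) (f₂ t)) s := by
  refine Integrable.mono' (h₁.norm.add h₂.norm) ?_ (Eventually.of_forall fun t => ?_)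
  · exact Real.continuous_sqrt.comp_aestronglyMeasurable
      ((h₁.aestronglyMeasurable.norm.pow 2).add (h₂.aestronglyMeasurable.norm.pow 2))
  · rw [normX0, Real.norm_of_nonneg (Real.sqrt_nonneg _), Pi.add_apply]
    refine Real.sqrt_le_iff.2 ⟨by positivity, ?_⟩
    nlinarith [norm_nonneg (f₁ t), norm_nonneg (f₂ t)]

theorem integrableOn_source {s : Set ℝ} {f₁ f₂ : ℝ → L2 L} (h₁ : IntegrableOn f₁ s)
    (h₂ : IntegrableOn f₂ s) : IntegrableOn (fun t => ((f₁ t, f₂ t, 0) : StateSpace L)) s :=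
  Integrable.prodMk h₁ (Integrable.prodMk h₂ (integrable_zero _ _ _))

theorem isClosed_isWeakDeriv_components : IsClosed {p : StateSpace L × (ℝ × ℝ × L2 L × L2 L) |
    IsWeakDeriv L p.1.1 p.2.2.2.1 ∧ IsWeakDeriv L p.1.2.1 p.2.2.2.2} := by
  have h1 : IsClosed {p : StateSpace L × (ℝ × ℝ × L2 L × L2 L) |
      IsWeakDeriv L p.1.1 p.2.2.2.1} :=
    isClosed_isWeakDeriv.preimage (f := fun p : StateSpace L × (ℝ × ℝ × L2 L × L2 L) =>
      (p.1.1, p.2.2.2.1)) (by fun_prop)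
  have h2 : IsClosed {p : StateSpace L × (ℝ × ℝ × L2 L × L2 L) |
      IsWeakDeriv L p.1.2.1 p.2.2.2.2} :=
    isClosed_isWeakDeriv.preimage (f := fun p : StateSpace L × (ℝ × ℝ × L2 L × L2 L) =>
      (p.1.2.1, p.2.2.2.2)) (by fun_prop)
  exact h1.inter h2

theorem integral_component {E F : Type*} [NormedAddCommGroup E] [NormedSpace ℝ E]
    [CompleteSpace E] [NormedAddCommGroup F] [NormedSpace ℝ F] [CompleteSpace F]
    (P : E →L[ℝ] F) {f : ℝ → E} {t : ℝ} (hf : IntervalIntegrable f volume 0 t) :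
    ∫ s in (0 : ℝ)..t, P (f s) = P (∫ s in (0 : ℝ)..t, f s) :=
  P.intervalIntegral_comp_comm hf

theorem isBoundarySlope_of_mild (hL : 0 < L) {U : ℝ → StateSpace L}
    {obs : ℝ → ℝ × ℝ × L2 L × L2 L} {G : ℝ → StateSpace L} (hUc : ContinuousOn U (Icc 0 T))
    (hU : ∀ t ∈ Icc 0 T, ∫ s in (0 : ℝ)..t, U s = inverseA L α β h (G t))
    (hm : MemLp obs 2 (volume.restrict (Ioo 0 T)))
    (hobs : ∀ t ∈ Icc 0 T, ∫ s in (0 : ℝ)..t, obs s = observation L α β h (G t)) :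
    IsBoundarySlope L T (fun t => (U t).1) L (fun t => (obs t).1) ∧
      IsBoundaryValue 1 T (fun t => (U t).2.2) 1 (fun t => (obs t).2.1) := by
  have hUi : ∀ t ∈ Icc 0 T, IntervalIntegrable U volume 0 t := fun t ht =>
    (hUc.mono (by rw [uIcc_of_le ht.1]; exact Icc_subset_Icc_right ht.2)).intervalIntegrable
  have hoi : ∀ t ∈ Icc 0 T, IntervalIntegrable obs volume 0 t := fun t ht =>
    (intervalIntegrable_iff_integrableOn_Ioo_of_le ht.1).2
      (IntegrableOn.mono_set (hm.integrable one_le_two) (Ioo_subset_Ioo_right ht.2))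
  refine ⟨⟨(ContinuousLinearMap.fst ℝ ℝ (ℝ × L2 L × L2 L)).comp_memLp' hm, fun t ht => ?_⟩,
    ⟨((ContinuousLinearMap.fst ℝ ℝ (L2 L × L2 L)) ∘L
      (ContinuousLinearMap.snd ℝ ℝ (ℝ × L2 L × L2 L))).comp_memLp' hm, fun t ht => ?_⟩⟩
  · have e1 := integral_component (ContinuousLinearMap.fst ℝ (L2 L) (L2 L × L2 1)) (hUi t ht)
    have e2 := integral_component (ContinuousLinearMap.fst ℝ ℝ (ℝ × L2 L × L2 L)) (hoi t ht)
    rw [hU t ht] at e1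
    rw [hobs t ht] at e2
    simp only [ContinuousLinearMap.coe_fst'] at e1 e2
    rw [e1, e2]
    exact ⟨sol₁ L (dataU L (G t)), isWeakDeriv_sol hL.le _, hasTrace_sol₁_right hL.le _⟩
  · have e1 := integral_component ((ContinuousLinearMap.snd ℝ (L2 L) (L2 1)) ∘L
      (ContinuousLinearMap.snd ℝ (L2 L) (L2 L × L2 1))) (hUi t ht)
    have e2 := integral_component ((ContinuousLinearMap.fst ℝ ℝ (L2 L × L2 L)) ∘L
      (ContinuousLinearMap.snd ℝ ℝ (ℝ × L2 L × L2 L))) (hoi t ht)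
    rw [hU t ht] at e1
    rw [hobs t ht] at e2
    simp only [ContinuousLinearMap.comp_apply, ContinuousLinearMap.coe_fst',
      ContinuousLinearMap.coe_snd'] at e1 e2
    rw [e1, e2]
    exact hasTrace_add_primitive_right zero_le_one _ _

theorem isL2H1_of_mem_closure (hL : 0 ≤ L) {U : ℝ → StateSpace L}
    {obs : ℝ → ℝ × ℝ × L2 L × L2 L} (hUm : MemLp U 2 (volume.restrict (Ioo 0 T)))
    (hm : MemLp obs 2 (volume.restrict (Ioo 0 T)))
    (hcl : ∀ᵐ t ∂(volume.restrict (Ioo 0 T)), (U t, obs t) ∈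
      closure (range fun V => (inverseA L α β h V, observation L α β h V))) :
    IsL2H1 L T (fun t => (U t).1) (fun t => (obs t).2.2.1) ∧
      IsL2H1 L T (fun t => (U t).2.1) (fun t => (obs t).2.2.2) := by
  have hw : ∀ᵐ t ∂(volume.restrict (Ioo 0 T)),
      IsWeakDeriv L (U t).1 (obs t).2.2.1 ∧ IsWeakDeriv L (U t).2.1 (obs t).2.2.2 := by
    filter_upwards [hcl] with t ht
    refine closure_minimal ?_ isClosed_isWeakDeriv_components ht
    rintro _ ⟨V, rfl⟩
    exact ⟨isWeakDeriv_sol hL _, isWeakDeriv_sol hL _⟩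
  refine ⟨⟨?_, ?_, hw.mono fun t ht => ht.1⟩, ⟨?_, ?_, hw.mono fun t ht => ht.2⟩⟩
  · exact (ContinuousLinearMap.fst ℝ (L2 L) (L2 L × L2 1)).comp_memLp' hUm
  · exact ((ContinuousLinearMap.fst ℝ (L2 L) (L2 L)) ∘L
      (ContinuousLinearMap.snd ℝ ℝ (L2 L × L2 L)) ∘L
      (ContinuousLinearMap.snd ℝ ℝ (ℝ × L2 L × L2 L))).comp_memLp' hm
  · exact ((ContinuousLinearMap.fst ℝ (L2 L) (L2 1)) ∘L
      (ContinuousLinearMap.snd ℝ (L2 L) (L2 L × L2 1))).comp_memLp' hUm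
  · exact ((ContinuousLinearMap.snd ℝ (L2 L) (L2 L)) ∘L
      (ContinuousLinearMap.snd ℝ ℝ (L2 L × L2 L)) ∘L
      (ContinuousLinearMap.snd ℝ ℝ (ℝ × L2 L × L2 L))).comp_memLp' hm

end MildSolution

end HirotaSatsuma

end

theorem theorem2p3 (L T α β h : ℝ) (hL : 0 < L) (hT : 0 < T) (hh : 0 < h) (hβ : 0 < β)
    (hcond : 0 < 2 * α ^ 2 + 3 / 2 * β ∧ 2 * α ^ 2 + 3 / 2 * β < 1 / 2) :
    -- existence and uniqueness in C([0, T]; H)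
    (∀ (U₀ : HirotaSatsuma.StateSpace L) (f₁ f₂ : ℝ → HirotaSatsuma.L2 L),
      IntegrableOn f₁ (Set.Ioo 0 T) → IntegrableOn f₂ (Set.Ioo 0 T) →
      ∃ U : ℝ → HirotaSatsuma.StateSpace L,
        HirotaSatsuma.IsMildSolution L T α β h U₀ f₁ f₂ U ∧
        ∀ V : ℝ → HirotaSatsuma.StateSpace L,
          HirotaSatsuma.IsMildSolution L T α β h U₀ f₁ f₂ V → Set.EqOn V U (Set.Icc 0 T)) ∧
    -- estimates, with a constant that does not depend on the data and the sources
    ∃ C : ℝ, 0 < C ∧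
      ∀ (U₀ : HirotaSatsuma.StateSpace L) (f₁ f₂ : ℝ → HirotaSatsuma.L2 L)
        (U : ℝ → HirotaSatsuma.StateSpace L),
        IntegrableOn f₁ (Set.Ioo 0 T) → IntegrableOn f₂ (Set.Ioo 0 T) →
        HirotaSatsuma.IsMildSolution L T α β h U₀ f₁ f₂ U →
        (∀ t ∈ Set.Icc 0 T, HirotaSatsuma.normH β h (U t) ≤
          C * (HirotaSatsuma.normH β h U₀
            + ∫ s in Set.Ioo 0 T, HirotaSatsuma.normX0 (f₁ s) (f₂ s))) ∧
        (∃ g ζ : ℝ → ℝ,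
          HirotaSatsuma.IsBoundarySlope L T (fun t => (U t).1) L g ∧
          HirotaSatsuma.IsBoundaryValue 1 T (fun t => (U t).2.2) 1 ζ ∧
          ∫ t in Set.Ioo 0 T, (g t ^ 2 + ζ t ^ 2) ≤
            C * (HirotaSatsuma.normH β h U₀ ^ 2
              + (∫ s in Set.Ioo 0 T, HirotaSatsuma.normX0 (f₁ s) (f₂ s)) ^ 2)) ∧
        (∃ p q : ℝ → HirotaSatsuma.L2 L,
          HirotaSatsuma.IsL2H1 L T (fun t => (U t).1) p ∧
          HirotaSatsuma.IsL2H1 L T (fun t => (U t).2.1) q ∧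
          Real.sqrt (∫ t in Set.Ioo 0 T,
              (‖(U t).1‖ ^ 2 + ‖p t‖ ^ 2 + ‖(U t).2.1‖ ^ 2 + ‖q t‖ ^ 2)) ≤
            C * (HirotaSatsuma.normH β h U₀
              + ∫ s in Set.Ioo 0 T, HirotaSatsuma.normX0 (f₁ s) (f₂ s))) := by
  open HirotaSatsuma Filter in
  have hβh : 0 < β * h := mul_pos hβ hh
  obtain ⟨K, hK, hdis⟩ := exists_energyForm_dissipative (h := h) hL hβ hcond.2
  have hc : 0 < min K (K * β * h) := lt_min hK (by positivity)
  have hcoer := energyForm_coercive (L := L) (β := β) (h := h) hL.le hK.le hβh.le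
  have hsymm := energyForm_comm (L := L) (β := β) (h := h) (K := K)
  have hinj := inverseA_injective (L := L) (α := α) (β := β) hL hh
  have hdis0 : ∀ W, energyForm L β h K W (inverseA L α β h W) ≤ 0 := fun W =>
    (hdis W).trans (by have := sq_nonneg ‖observation L α β h W‖; linarith)
  obtain ⟨C₀, hC₀, hex⟩ := exists_mild_solution hasLaxMilgram_stateSpace hc hcoer hsymm hinj
    one_half_pos hdis hT.le
  refine ⟨fun U₀ f₁ f₂ h₁ h₂ => ?_, ?_⟩
  · obtain ⟨U, -, hUc, hU, -⟩ := hex U₀ _ (integrableOn_source h₁ h₂)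
    refine ⟨U, (isMildSolution_iff hL hT.le hh).2 ⟨hUc.continuousOn, hU⟩, fun V hV => ?_⟩
    obtain ⟨hVc, hV⟩ := (isMildSolution_iff hL hT.le hh).1 hV
    refine eqOn_of_mild hc hcoer hsymm hdis0 hinj hT.le
      (G := fun t => U₀ + ∫ s in (0 : ℝ)..t, ((f₁ s, f₂ s, 0) : StateSpace L))
      hVc hUc.continuousOn ?_ ?_
    · simpa only [sub_add_eq_sub_sub] using hV
    · simpa only [sub_add_eq_sub_sub] using hU
  set c₁ := √(min 1 (β * h)) with hc₁
  have hc₁0 : 0 < c₁ := Real.sqrt_pos.2 (lt_min one_pos hβh)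
  set D := 1 / c₁ + 1 with hD
  have hD0 : 0 < D := by positivity
  set K₁ := √(2 + β * h) * C₀ * D with hK₁
  set K₂ := 4 * C₀ * D ^ 2 with hK₂
  set K₃ := √(2 * T * C₀ ^ 2 + 2 * C₀) * D with hK₃
  have hK₁0 : 0 ≤ K₁ := by positivity
  have hK₂0 : 0 ≤ K₂ := by positivity
  have hK₃0 : 0 ≤ K₃ := by positivity
  refine ⟨K₁ + K₂ + K₃ + 1, by positivity, fun U₀ f₁ f₂ V h₁ h₂ hVm => ?_⟩
  set F : ℝ → StateSpace L := fun s => (f₁ s, f₂ s, 0) with hF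
  have hFi : IntegrableOn F (Ioo 0 T) := integrableOn_source h₁ h₂
  obtain ⟨U, obs, hUc, hU, hom, hobs, hsup, hoL2, hcl⟩ := hex U₀ F hFi
  obtain ⟨hVc, hV⟩ := (isMildSolution_iff hL hT.le hh).1 hVm
  have hVU : EqOn V U (Icc 0 T) :=
    eqOn_of_mild hc hcoer hsymm hdis0 hinj hT.le (G := fun t => U₀ + ∫ s in (0 : ℝ)..t, F s)
      hVc hUc.continuousOn (by simpa only [sub_add_eq_sub_sub] using hV)
      (by simpa only [sub_add_eq_sub_sub] using hU)
  set S := ∫ s in Ioo 0 T, normX0 (f₁ s) (f₂ s) with hS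
  have hS0 : 0 ≤ S := integral_nonneg fun _ => Real.sqrt_nonneg _
  set N := ‖U₀‖ + ∫ s in (0 : ℝ)..T, ‖F s‖ with hN
  set H₀ := normH β h U₀ with hH₀
  have hH₀0 : 0 ≤ H₀ := Real.sqrt_nonneg _
  have hN0 : 0 ≤ N :=
    add_nonneg (norm_nonneg _) (intervalIntegral.integral_nonneg hT.le fun _ _ => norm_nonneg _)
  have hNle : N ≤ D * (H₀ + S) := by
    have e1 : ‖U₀‖ ≤ 1 / c₁ * H₀ := by
      rw [one_div_mul_eq_div, le_div_iff₀ hc₁0, mul_comm]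
      exact norm_le_normH hβh U₀
    have e2 : ∫ s in (0 : ℝ)..T, ‖F s‖ ≤ S := by
      rw [intervalIntegral.integral_of_le hT.le, integral_Ioc_eq_integral_Ioo]
      exact integral_mono hFi.norm (integrableOn_normX0 h₁ h₂)
        fun s => norm_source_le_normX0 _ _
    have e3 : 0 ≤ 1 / c₁ * S := by positivity
    rw [hN, hD, add_mul, one_mul, mul_add]
    linarith
  have hsq : D * (H₀ + S) ≥ 0 := by positivity
  have hoint : Integrable (fun t => ‖obs t‖ ^ 2) (volume.restrict (Ioo 0 T)) :=
    hom.integrable_norm_pow two_ne_zero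
  refine ⟨fun t ht => ?_, ?_, ?_⟩
  · rw [hVU ht]
    calc normH β h (U t) ≤ √(2 + β * h) * ‖U t‖ := normH_le_norm hβh _
      _ ≤ √(2 + β * h) * (C₀ * (D * (H₀ + S))) := by
          gcongr
          exact (hsup t ht).trans (by gcongr)
      _ = K₁ * (H₀ + S) := by rw [hK₁]; ring
      _ ≤ _ := by gcongr; linarith
  · obtain ⟨hs1, hs2⟩ := isBoundarySlope_of_mild hL hVc hV hom fun t ht => by
      rw [hobs t ht, hVU ht]
    refine ⟨_, _, hs1, hs2, ?_⟩
    calc ∫ t in Ioo 0 T, ((obs t).1 ^ 2 + (obs t).2.1 ^ 2)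
        ≤ ∫ t in Ioo 0 T, 2 * ‖obs t‖ ^ 2 := by
          refine integral_mono_of_nonneg (Eventually.of_forall fun t => by positivity)
            (hoint.const_mul 2) (Eventually.of_forall fun t => ?_)
          have e1 : ‖(obs t).1‖ ^ 2 ≤ ‖obs t‖ ^ 2 := by gcongr; exact norm_fst_le _
          have e2 : ‖(obs t).2.1‖ ^ 2 ≤ ‖obs t‖ ^ 2 := by
            gcongr; exact (norm_fst_le _).trans (norm_snd_le _)
          rw [Real.norm_eq_abs, sq_abs] at e1 e2
          simp only
          linarith
      _ ≤ 2 * (C₀ * (D * (H₀ + S)) ^ 2) := by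
          rw [integral_const_mul]
          gcongr
          exact hoL2.trans (by gcongr)
      _ ≤ K₂ * (H₀ ^ 2 + S ^ 2) := by
          have e : (H₀ + S) ^ 2 ≤ 2 * (H₀ ^ 2 + S ^ 2) := by nlinarith [sq_nonneg (H₀ - S)]
          calc 2 * (C₀ * (D * (H₀ + S)) ^ 2) = 2 * C₀ * D ^ 2 * (H₀ + S) ^ 2 := by ring
            _ ≤ 2 * C₀ * D ^ 2 * (2 * (H₀ ^ 2 + S ^ 2)) := by gcongr
            _ = _ := by rw [hK₂]; ring
      _ ≤ _ := by gcongr; linarith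
  · have hcl' : ∀ᵐ t ∂(volume.restrict (Ioo 0 T)), (V t, obs t) ∈
        closure (range fun W => (inverseA L α β h W, observation L α β h W)) := by
      filter_upwards [hcl, ae_restrict_mem measurableSet_Ioo] with t ht htT
      rwa [hVU (Ioo_subset_Icc_self htT)]
    have hVLp : MemLp V 2 (volume.restrict (Ioo 0 T)) := by
      refine MemLp.ae_eq ?_ (memLp_of_continuous hUc T)
      filter_upwards [ae_restrict_mem measurableSet_Ioo] with t ht
      exact (hVU (Ioo_subset_Icc_self ht)).symm
    obtain ⟨hp, hq⟩ := isL2H1_of_mem_closure hL.le hVLp hom hcl'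
    refine ⟨_, _, hp, hq, ?_⟩
    have hle : ∫ t in Ioo 0 T, (‖(V t).1‖ ^ 2 + ‖(obs t).2.2.1‖ ^ 2 + ‖(V t).2.1‖ ^ 2 +
        ‖(obs t).2.2.2‖ ^ 2) ≤ (2 * T * C₀ ^ 2 + 2 * C₀) * (D * (H₀ + S)) ^ 2 := by
      calc _ ≤ ∫ t in Ioo 0 T, (2 * (C₀ * (D * (H₀ + S))) ^ 2 + 2 * ‖obs t‖ ^ 2) := by
            refine integral_mono_of_nonneg (Eventually.of_forall fun t => by positivity)
              ((integrable_const _).add (hoint.const_mul 2)) ?_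
            filter_upwards [ae_restrict_mem measurableSet_Ioo] with t ht
            have htI := Ioo_subset_Icc_self ht
            have e0 : ‖V t‖ ≤ C₀ * (D * (H₀ + S)) := by
              rw [hVU htI]; exact (hsup t htI).trans (by gcongr)
            have e1 : ‖(V t).1‖ ^ 2 ≤ (C₀ * (D * (H₀ + S))) ^ 2 := by
              gcongr; exact (norm_fst_le _).trans e0
            have e2 : ‖(V t).2.1‖ ^ 2 ≤ (C₀ * (D * (H₀ + S))) ^ 2 := by
              gcongr; exact ((norm_fst_le _).trans (norm_snd_le _)).trans e0
            have e3 : ‖(obs t).2.2.1‖ ^ 2 ≤ ‖obs t‖ ^ 2 := by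
              gcongr; exact ((norm_fst_le _).trans (norm_snd_le _)).trans (norm_snd_le _)
            have e4 : ‖(obs t).2.2.2‖ ^ 2 ≤ ‖obs t‖ ^ 2 := by
              gcongr; exact ((norm_snd_le _).trans (norm_snd_le _)).trans (norm_snd_le _)
            linarith
        _ ≤ T * (2 * (C₀ * (D * (H₀ + S))) ^ 2) + 2 * (C₀ * (D * (H₀ + S)) ^ 2) := by
            rw [integral_add (integrable_const _) (hoint.const_mul 2), setIntegral_const,
              integral_const_mul, Real.volume_real_Ioo_of_le hT.le, sub_zero, smul_eq_mul]
            have e := hoL2.trans (show C₀ * N ^ 2 ≤ C₀ * (D * (H₀ + S)) ^ 2 by gcongr)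
            linarith
        _ = _ := by ring
    calc _ ≤ √((2 * T * C₀ ^ 2 + 2 * C₀) * (D * (H₀ + S)) ^ 2) := Real.sqrt_le_sqrt hle
      _ = K₃ * (H₀ + S) := by
          rw [Real.sqrt_mul (by positivity), Real.sqrt_sq hsq, hK₃]; ring
      _ ≤ _ := by gcongr; linarith
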